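/- Let $\mathbb{K}$ be a commutative ring and $A$ a (unital, associative, not necessarily commutative or flat) $\mathbb{K}$-algebra. Let $s\in A$ be normal ($As=sA$) and regular ($s$ is neither a left nor a right zero-divisor), so that $\{s^n\}_{n\ge 0}$ is a left denominator set; let $A_s$ be the localisation of $A$ at it. Let $\operatorname{K}(A;s)=(\cdots\to 0\to A\to A_s\to 0\to\cdots)$ be the complex of $A$-bimodules (modules over $A\otimes_{\mathbb{K}}A^{\mathrm{op}}$) with $A$ in degree $0$, $A_s$ in degree $1$, and differential the localisation map. Let $\Lambda_s$ be the $(s)$-adic completion functor $M\mapsto\varprojlim_{n} M/s^nM$ on left $A$-modules, extended termwise to complexes. Let $\mathrm{D}(A)$ be the (unbounded) derived category of left $A$-modules. Then the right derived functor $\mathrm{RHom}_A(\operatorname{K}(A;s),-)$ of $\mathrm{Hom}_A(\operatorname{K}(A;s),-)$ and the left derived functor $\mathrm{L}\Lambda_s$ of $\Lambda_s$ exist as $\mathbb{K}$-linear triangulated functors $\mathrm{D}(A)\to\mathrm{D}(A)$, and there is an isomorphism $$\omega_s:\ \mathrm{RHom}_A(\operatorname{K}(A;s),-)\ \xrightarrow{\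 \cong\ }\ \mathrm{L}\Lambda_s$$ of triangulated functors from $\mathrm{D}(A)$ to itself. -/

import Mathlib

open CategoryTheory
open scoped TensorProduct

universe w t u

/-! ### Derived functors as triangulated functors -/

section Derived

variable (𝕂 : Type t) [CommRing 𝕂]
  {C : Type*} [Category C] [Abelian C] [Linear 𝕂 C] [HasDerivedCategory C]
  {D : Type*} [Category D] [Abelian D] [Linear 𝕂 D] [HasDerivedCategory D]
  (F : HomotopyCategory C (ComplexShape.up ℤ) ⥤ HomotopyCategory D (ComplexShape.up ℤ))
  [F.CommShift ℤ]

/-- A right derived functor `(RF, η)` of a functor `F : K(C) ⥤ K(D)` commuting with shifts: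
a `𝕂`-linear triangulated functor `RF : D(C) ⥤ D(D)` with a morphism
`η : Q ∘ F ⟶ RF ∘ Q`, compatible with the shifts, having the universal property of the
right derived functor. -/
structure TriangulatedRightDerivedFunctor where
  /-- the functor `RF` -/
  functor : DerivedCategory C ⥤ DerivedCategory D
  /-- the commutation of `RF` with the shifts -/
  commShift : functor.CommShift ℤ
  isTriangulated : functor.IsTriangulated
  linear : functor.Linear 𝕂
  /-- the morphism `η` -/
  unit : F ⋙ DerivedCategory.Qh ⟶ DerivedCategory.Qh ⋙ functor
  unit_commShift : NatTrans.CommShift unit ℤ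
  isRightDerived : functor.IsRightDerivedFunctor unit
    (HomotopyCategory.quasiIso C (ComplexShape.up ℤ))

/-- A left derived functor `(LF, η)` of a functor `F : K(C) ⥤ K(D)` commuting with shifts:
a `𝕂`-linear triangulated functor `LF : D(C) ⥤ D(D)` with a morphism
`η : LF ∘ Q ⟶ Q ∘ F`, compatible with the shifts, having the universal property of the
left derived functor. -/
structure TriangulatedLeftDerivedFunctor where
  /-- the functor `LF` -/
  functor : DerivedCategory C ⥤ DerivedCategory D
  /-- the commutation of `LF` with the shifts -/
  commShift : functor.CommShift ℤ
  isTriangulated : functor.IsTriangulated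
  linear : functor.Linear 𝕂
  /-- the morphism `η` -/
  counit : DerivedCategory.Qh ⋙ functor ⟶ F ⋙ DerivedCategory.Qh
  counit_commShift : NatTrans.CommShift counit ℤ
  isLeftDerived : functor.IsLeftDerivedFunctor counit
    (HomotopyCategory.quasiIso C (ComplexShape.up ℤ))

attribute [instance] TriangulatedRightDerivedFunctor.commShift
  TriangulatedLeftDerivedFunctor.commShift

end Derived

/-! ### The functor `Hom_A(K, -)` for a complex of bimodules `K` -/

section HomFunctor

open CochainComplex HomComplex MulOpposite

variable {𝕂 : Type t} [CommRing 𝕂] {A : Type u} [Ring A] [Algebra 𝕂 A]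

variable (𝕂 A) in
/-- The ring homomorphism `A → A ⊗[𝕂] Aᵐᵒᵖ`, `a ↦ a ⊗ 1`. -/
noncomputable abbrev toEnveloping : A →+* A ⊗[𝕂] Aᵐᵒᵖ :=
  (Algebra.TensorProduct.includeLeft : A →ₐ[𝕂] A ⊗[𝕂] Aᵐᵒᵖ).toRingHom

/-- The complex of left `A`-modules underlying a complex of `A`-bimodules, i.e. of left modules
over `A ⊗[𝕂] Aᵐᵒᵖ`. -/
noncomputable def leftComplex (K : CochainComplex (ModuleCat.{u} (A ⊗[𝕂] Aᵐᵒᵖ)) ℤ) :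
    CochainComplex (ModuleCat.{u} A) ℤ :=
  ((ModuleCat.restrictScalars.{u} (toEnveloping 𝕂 A)).mapHomologicalComplex
      (ComplexShape.up ℤ)).obj K

/-- Right multiplication `x ↦ x a` on a bimodule, as a map of left `A`-modules. -/
noncomputable def rightMulModule (M : ModuleCat.{u} (A ⊗[𝕂] Aᵐᵒᵖ)) (a : A) :
    (ModuleCat.restrictScalars.{u} (toEnveloping 𝕂 A)).obj M ⟶
    (ModuleCat.restrictScalars.{u} (toEnveloping 𝕂 A)).obj M :=
  ModuleCat.ofHom (X := (ModuleCat.restrictScalars.{u} (toEnveloping 𝕂 A)).obj M)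
    (Y := (ModuleCat.restrictScalars.{u} (toEnveloping 𝕂 A)).obj M)
    { toFun := fun x => ((1 : A) ⊗ₜ[𝕂] op a) • (show M from x)
      map_add' := fun x y => smul_add ((1 : A) ⊗ₜ[𝕂] op a) (show M from x) (show M from y)
      map_smul' := fun b x => by
        change ((1 : A) ⊗ₜ[𝕂] op a) • ((b ⊗ₜ[𝕂] (1 : Aᵐᵒᵖ)) • (show M from x)) =
          (b ⊗ₜ[𝕂] (1 : Aᵐᵒᵖ)) • (((1 : A) ⊗ₜ[𝕂] op a) • (show M from x))
        rw [smul_smul, smul_smul]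
        simp }

/-- Right multiplication by `a` on a complex of bimodules, as a map of complexes of left
`A`-modules. -/
noncomputable def rightMul (K : CochainComplex (ModuleCat.{u} (A ⊗[𝕂] Aᵐᵒᵖ)) ℤ) (a : A) :
    leftComplex K ⟶ leftComplex K where
  f i := rightMulModule (K.X i) a
  comm' i j _ := by
    ext x
    exact map_smul (K.d i j).hom ((1 : A) ⊗ₜ[𝕂] op a) (show K.X i from x)

variable (K : CochainComplex (ModuleCat.{u} (A ⊗[𝕂] Aᵐᵒᵖ)) ℤ)

lemma rightMul_one : rightMul K 1 = 𝟙 _ := by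
  ext i x
  exact one_smul (A ⊗[𝕂] Aᵐᵒᵖ) (show K.X i from x)

lemma rightMul_mul (a b : A) : rightMul K (a * b) = rightMul K a ≫ rightMul K b := by
  ext i x
  change ((1 : A) ⊗ₜ[𝕂] op (a * b)) • (show K.X i from x) =
    ((1 : A) ⊗ₜ[𝕂] op b) • (((1 : A) ⊗ₜ[𝕂] op a) • (show K.X i from x))
  rw [smul_smul]
  simp

lemma rightMul_add (a b : A) : rightMul K (a + b) = rightMul K a + rightMul K b := by
  ext i x
  change ((1 : A) ⊗ₜ[𝕂] op (a + b)) • (show K.X i from x) =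
    ((1 : A) ⊗ₜ[𝕂] op a) • (show K.X i from x) + ((1 : A) ⊗ₜ[𝕂] op b) • (show K.X i from x)
  rw [← add_smul, MulOpposite.op_add, TensorProduct.tmul_add]

lemma rightMul_zero : rightMul K 0 = 0 := by
  have h := rightMul_add K 0 0
  simpa using h

/-- The left action of `A` on `Hom_A(K, M)ⁿ = ∏ₚ Hom_A(Kᵖ, Mᵖ⁺ⁿ)` is `(a f)(x) = f (x a)`. -/
noncomputable instance homCochainModule (M : CochainComplex (ModuleCat.{u} A) ℤ) (n : ℤ) :
    Module A (Cochain (leftComplex K) M n) where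
  smul a z := (Cochain.ofHom (rightMul K a)).comp z (zero_add n)
  one_smul z := by
    change (Cochain.ofHom (rightMul K 1)).comp z (zero_add n) = z
    rw [rightMul_one, Cochain.id_comp]
  mul_smul a b z := by
    change (Cochain.ofHom (rightMul K (a * b))).comp z (zero_add n) =
      (Cochain.ofHom (rightMul K a)).comp
        ((Cochain.ofHom (rightMul K b)).comp z (zero_add n)) (zero_add n)
    rw [rightMul_mul, Cochain.ofHom_comp, Cochain.comp_assoc_of_first_is_zero_cochain]
  smul_zero a := Cochain.comp_zero _ _
  smul_add a z z' := Cochain.comp_add _ _ _ _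
  add_smul a b z := by
    change (Cochain.ofHom (rightMul K (a + b))).comp z (zero_add n) = _
    rw [rightMul_add, Cochain.ofHom_add, Cochain.add_comp]
    rfl
  zero_smul z := by
    change (Cochain.ofHom (rightMul K 0)).comp z (zero_add n) = 0
    rw [rightMul_zero, Cochain.ofHom_zero, Cochain.zero_comp]

lemma homCochain_smul_def (M : CochainComplex (ModuleCat.{u} A) ℤ) (n : ℤ) (a : A)
    (z : Cochain (leftComplex K) M n) :
    a • z = (Cochain.ofHom (rightMul K a)).comp z (zero_add n) := rfl

/-- The complex of left `A`-modules `Hom_A(K, M)`, with differential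
`f ↦ d ∘ f - (-1)ⁿ f ∘ d` in degree `n`. -/
noncomputable def homComplexObj (M : CochainComplex (ModuleCat.{u} A) ℤ) :
    CochainComplex (ModuleCat.{u} A) ℤ where
  X n := ModuleCat.of A (Cochain (leftComplex K) M n)
  d i j := ModuleCat.ofHom
    { toFun := δ i j
      map_add' := δ_add i j
      map_smul' := fun a z => by
        simp only [homCochain_smul_def, δ_ofHom_comp, RingHom.id_apply] }
  shape i j hij := by
    exact ModuleCat.hom_ext (LinearMap.ext fun z => δ_shape i j hij z)
  d_comp_d' i j k _ _ := by
    exact ModuleCat.hom_ext (LinearMap.ext fun z => δ_δ i j k z)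

/-- The map `Hom_A(K, f) : Hom_A(K, M) ⟶ Hom_A(K, N)`. -/
noncomputable def homComplexMap {M N : CochainComplex (ModuleCat.{u} A) ℤ} (f : M ⟶ N) :
    homComplexObj K M ⟶ homComplexObj K N where
  f n := ModuleCat.ofHom
    (X := Cochain (leftComplex K) M n) (Y := Cochain (leftComplex K) N n)
    { toFun := fun z => z.comp (Cochain.ofHom f) (add_zero n)
      map_add' := fun z z' => Cochain.add_comp _ _ _ _
      map_smul' := fun a z => by
        simp only [homCochain_smul_def, RingHom.id_apply]
        rw [Cochain.comp_assoc_of_first_is_zero_cochain] }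
  comm' i j _ := by
    ext z
    exact δ_comp_ofHom (show Cochain (leftComplex K) M i from z) f j

/-- The functor `Hom_A(K, -) : C(A) ⥤ C(A)`. -/
noncomputable def homComplexFunctor :
    CochainComplex (ModuleCat.{u} A) ℤ ⥤ CochainComplex (ModuleCat.{u} A) ℤ where
  obj M := homComplexObj K M
  map f := homComplexMap K f
  map_id M := by
    ext n z
    exact Cochain.comp_id (show Cochain (leftComplex K) M n from z)
  map_comp {M N P} f g := by
    ext n z
    change (show Cochain (leftComplex K) M n from z).comp (Cochain.ofHom (f ≫ g)) (add_zero n) =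
      ((show Cochain (leftComplex K) M n from z).comp (Cochain.ofHom f) (add_zero n)).comp
        (Cochain.ofHom g) (add_zero n)
    rw [Cochain.ofHom_comp, Cochain.comp_assoc_of_third_is_zero_cochain]

/-- The identification `Hom_A(K, M[a]) ≅ Hom_A(K, M)[a]`; it involves no signs. -/
noncomputable def homComplexShiftIso (a : ℤ) (M : CochainComplex (ModuleCat.{u} A) ℤ) :
    homComplexObj K (M⟦a⟧) ≅ (homComplexObj K M)⟦a⟧ :=
  HomologicalComplex.Hom.isoOfComponents
    (fun n => LinearEquiv.toModuleIso
      (X₁ := Cochain (leftComplex K) (M⟦a⟧) n) (X₂ := Cochain (leftComplex K) M (n + a))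
      { toFun := fun z => z.rightUnshift (n + a) rfl
        invFun := fun z => z.rightShift a n rfl
        left_inv := fun z => Cochain.rightShift_rightUnshift z (n + a) rfl
        right_inv := fun z => Cochain.rightUnshift_rightShift z a n rfl
        map_add' := fun z z' => Cochain.rightUnshift_add z z' (n + a) rfl
        map_smul' := fun b z => by
          ext p q hpq
          simp only [homCochain_smul_def, RingHom.id_apply]
          rw [Cochain.rightUnshift_v _ _ _ p q hpq (p + n) rfl, Cochain.zero_cochain_comp_v,
            Cochain.zero_cochain_comp_v, Cochain.rightUnshift_v _ _ _ p q hpq (p + n) rfl,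
            Category.assoc] })
    (fun i j _ => by
      refine ModuleCat.hom_ext (LinearMap.ext fun z => ?_)
      have h := Cochain.δ_rightUnshift (show Cochain (leftComplex K) (M⟦a⟧) i from z) (i + a) rfl
        (j + a) j rfl
      rw [CochainComplex.shiftFunctor_obj_d']
      change (a.negOnePow • δ (i + a) (j + a) ((show Cochain (leftComplex K) (M⟦a⟧) i from
        z).rightUnshift (i + a) rfl) : Cochain (leftComplex K) M (j + a)) = _
      rw [h, smul_smul, Int.units_mul_self, one_smul]
      rfl)

lemma eq_comp_XIsoOfEq_hom {K : CochainComplex (ModuleCat.{u} A) ℤ} {X : ModuleCat.{u} A}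
    {i j k : ℤ} (h₁ : i = j) (h₂ : j = k) (h₃ : k = i) (f : X ⟶ K.X i) :
    f = ((f ≫ (K.XIsoOfEq h₁).hom) ≫ (K.XIsoOfEq h₂).hom) ≫ (K.XIsoOfEq h₃).hom := by
  subst h₁ h₂
  simp

lemma homComplexObj_XIsoOfEq_hom_v (M : CochainComplex (ModuleCat.{u} A) ℤ) {m n : ℤ} (h : m = n)
    (z : Cochain (leftComplex K) M m) (p q : ℤ) (hpq : p + n = q) :
    Cochain.v (show Cochain (leftComplex K) M n from
      ((homComplexObj K M).XIsoOfEq h).hom.hom z) p q hpq = z.v p q (by rw [h, hpq]) := by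
  subst h
  rfl

/-- The functor `Hom_A(K, -) : C(A) ⥤ C(A)` commutes with the shifts. -/
noncomputable instance homComplexFunctorCommShift : (homComplexFunctor K).CommShift ℤ where
  commShiftIso a := NatIso.ofComponents (fun M => homComplexShiftIso K a M) (fun {M N} f => by
    ext n : 1
    refine ModuleCat.hom_ext (LinearMap.ext fun z => ?_)
    change ((show Cochain (leftComplex K) (M⟦a⟧) n from z).comp (Cochain.ofHom (f⟦a⟧'))
        (add_zero n)).rightUnshift (n + a) rfl =
      ((show Cochain (leftComplex K) (M⟦a⟧) n from z).rightUnshift (n + a) rfl).comp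
        (Cochain.ofHom f) (add_zero _)
    ext1 p q hpq
    rw [Cochain.rightUnshift_v _ _ _ p q hpq (p + n) rfl, Cochain.comp_zero_cochain_v,
      Cochain.comp_zero_cochain_v, Cochain.rightUnshift_v _ _ _ p q hpq (p + n) rfl]
    obtain rfl : q = p + n + a := by lia
    simp only [Cochain.ofHom_v, CochainComplex.shiftFunctorObjXIso,
      CochainComplex.shiftFunctor_map_f', HomologicalComplex.XIsoOfEq_rfl, Iso.refl_hom]
    change (_ ≫ f.f (p + n + a)) ≫ 𝟙 _ = (_ ≫ 𝟙 _) ≫ f.f (p + n + a)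
    erw [Category.comp_id])
  commShiftIso_zero := by
    ext M n : 5
    refine LinearMap.ext ?_
    intro (z : Cochain (leftComplex K) (M⟦(0 : ℤ)⟧) n)
    rw [Functor.CommShift.isoZero_hom_app]
    change z.rightUnshift (n + 0) rfl = (show Cochain (leftComplex K) M (n + 0) from
      (((CategoryTheory.shiftFunctorZero (CochainComplex (ModuleCat.{u} A) ℤ) ℤ).inv.app
        (homComplexObj K M)).f n).hom (z.comp (Cochain.ofHom ((CategoryTheory.shiftFunctorZero
          (CochainComplex (ModuleCat.{u} A) ℤ) ℤ).hom.app M)) (add_zero n)))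
    rw [CochainComplex.shiftFunctorZero_inv_app_f]
    ext1 p q hpq
    refine Eq.trans ?_ (homComplexObj_XIsoOfEq_hom_v K M _ _ p q hpq).symm
    rw [Cochain.rightUnshift_v _ _ _ p q hpq q (by lia), Cochain.comp_zero_cochain_v,
      Cochain.ofHom_v, CochainComplex.shiftFunctorZero_hom_app_f]
    rfl
  commShiftIso_add a b := by
    ext M n : 5
    refine LinearMap.ext ?_
    intro (z : Cochain (leftComplex K) (M⟦a + b⟧) n)
    rw [Functor.CommShift.isoAdd_hom_app]
    change z.rightUnshift (n + (a + b)) rfl = (show Cochain (leftComplex K) M (n + (a + b)) from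
      (((CategoryTheory.shiftFunctorAdd (CochainComplex (ModuleCat.{u} A) ℤ) a b).inv.app
        (homComplexObj K M)).f n).hom
          (((z.comp (Cochain.ofHom ((CategoryTheory.shiftFunctorAdd
            (CochainComplex (ModuleCat.{u} A) ℤ) a b).hom.app M)) (add_zero n)).rightUnshift
              (n + b) rfl).rightUnshift (n + b + a) rfl))
    rw [CochainComplex.shiftFunctorAdd_inv_app_f]
    ext1 p q hpq
    refine Eq.trans ?_ (homComplexObj_XIsoOfEq_hom_v K M _ _ p q hpq).symm
    obtain rfl : q = p + n + (a + b) := by lia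
    rw [Cochain.rightUnshift_v _ _ _ p _ hpq (p + n) rfl,
      Cochain.rightUnshift_v _ _ _ p _ _ (p + (n + b)) rfl,
      Cochain.rightUnshift_v _ _ _ p _ _ (p + n) rfl,
      Cochain.comp_zero_cochain_v,
      Cochain.ofHom_v, CochainComplex.shiftFunctorAdd_hom_app_f]
    simp only [CochainComplex.shiftFunctorObjXIso, HomologicalComplex.XIsoOfEq_rfl, Iso.refl_hom]
    erw [Category.comp_id]
    exact eq_comp_XIsoOfEq_hom (K := M) _ (by dsimp; lia) _ (z.v p (p + n) rfl)

/-- A homotopy `f ∼ g` induces a homotopy `Hom_A(K, f) ∼ Hom_A(K, g)`. -/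
lemma homComplexMap_homotopic {M N : CochainComplex (ModuleCat.{u} A) ℤ} (f g : M ⟶ N)
    (h : Nonempty (Homotopy f g)) :
    Nonempty (Homotopy (homComplexMap K f) (homComplexMap K g)) := by
  obtain ⟨y, hy⟩ := Cochain.equivHomotopy f g h.some
  let H (i : ℤ) (j : ℤ) (hij : i + (-1) = j) : (homComplexObj K M).X i ⟶ (homComplexObj K N).X j :=
    ModuleCat.ofHom (X := Cochain (leftComplex K) M i) (Y := Cochain (leftComplex K) N j)
    { toFun := fun z => z.comp y hij
      map_add' := fun z z' => Cochain.add_comp _ _ _ _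
      map_smul' := fun a z => by
        simp only [homCochain_smul_def, RingHom.id_apply]
        rw [Cochain.comp_assoc_of_first_is_zero_cochain] }
  refine ⟨(Cochain.equivHomotopy _ _).symm ⟨Cochain.mk H, ?_⟩⟩
  refine Cochain.ext₀ _ _ (fun n => ?_)
  rw [Cochain.add_v, δ_v (-1) 0 (by lia) _ n n (by lia) (n - 1) (n + 1) rfl rfl,
    Cochain.mk_v, Cochain.mk_v, Cochain.ofHom_v, Cochain.ofHom_v]
  refine ModuleCat.hom_ext (LinearMap.ext ?_)
  intro (z : Cochain (leftComplex K) M n)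
  have h1 := δ_comp z y (show n + (-1) = n - 1 by lia) (n + 1) 0 n (by lia) rfl (by lia)
  simp only [Int.negOnePow_neg, Int.negOnePow_one, Int.negOnePow_zero, one_smul, Units.neg_smul] at h1 ⊢
  change z.comp (Cochain.ofHom f) (add_zero n) =
    (δ (n - 1) n (z.comp y (show n + (-1) = n - 1 by lia)) +
      (δ n (n + 1) z).comp y (show n + 1 + (-1) = n by lia)) +
      z.comp (Cochain.ofHom g) (add_zero n)
  rw [h1, hy, Cochain.comp_add]
  abel

/-- The functor `Hom_A(K, -) : K(A) ⥤ K(A)` between homotopy categories. -/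
noncomputable def homHomotopyFunctor :
    HomotopyCategory (ModuleCat.{u} A) (ComplexShape.up ℤ) ⥤
      HomotopyCategory (ModuleCat.{u} A) (ComplexShape.up ℤ) :=
  CategoryTheory.Quotient.lift _ (homComplexFunctor K ⋙ HomotopyCategory.quotient _ _)
    (fun _ _ f g h => HomotopyCategory.eq_of_homotopy _ _ (homComplexMap_homotopic K f g h).some)

noncomputable instance homHomotopyFunctorCommShift : (homHomotopyFunctor K).CommShift ℤ :=
  Quotient.liftCommShift _ _ _ _

end HomFunctor

/-! ### Normal regular elements and the complex `K(A; s)` -/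

section Koszul

open MulOpposite

/-- `s` is normal if `A s = s A`. -/
def IsNormalElement {A : Type u} [Ring A] (s : A) : Prop :=
  Set.range (fun a : A => a * s) = Set.range (fun a : A => s * a)

section

variable {A : Type u} [Ring A] {s : A}

lemma IsNormalElement.exists_pow_mul (hn : IsNormalElement s) (n : ℕ) (a : A) :
    ∃ b : A, s ^ n * a = b * s ^ n := by
  induction n generalizing a with
  | zero => exact ⟨a, by simp⟩
  | succ n ih =>
    obtain ⟨b, hb⟩ : s * a ∈ Set.range (fun a : A => a * s) := by
      rw [show Set.range (fun a : A => a * s) = _ from hn]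
      exact ⟨a, rfl⟩
    obtain ⟨c, hc⟩ := ih b
    refine ⟨c, ?_⟩
    dsimp at hb
    rw [pow_succ, mul_assoc, ← hb, ← mul_assoc, hc, mul_assoc]

lemma IsNormalElement.exists_mul_pow (hn : IsNormalElement s) (n : ℕ) (a : A) :
    ∃ b : A, a * s ^ n = s ^ n * b := by
  induction n generalizing a with
  | zero => exact ⟨a, by simp⟩
  | succ n ih =>
    obtain ⟨b, hb⟩ : a * s ∈ Set.range (fun a : A => s * a) := by
      rw [← show Set.range (fun a : A => a * s) = _ from hn]
      exact ⟨a, rfl⟩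
    obtain ⟨c, hc⟩ := ih b
    refine ⟨c, ?_⟩
    dsimp at hb
    rw [pow_succ', ← mul_assoc, ← hb, mul_assoc, hc, mul_assoc]

lemma IsNormalElement.exists_mul_mem (hn : IsNormalElement s) (t : Submonoid.powers s) (a : A) :
    ∃ b : A, (t : A) * a = b * t := by
  obtain ⟨_, n, rfl⟩ := t
  exact hn.exists_pow_mul n a

/-- For `s` normal and regular, `{sⁿ}` is a left denominator set. -/
noncomputable abbrev IsNormalElement.oreSet (hn : IsNormalElement s) (hr : IsRegular s) :
    OreLocalization.OreSet (Submonoid.powers s) where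
  ore_right_cancel a b t h := by
    obtain ⟨n, hn⟩ := t.2
    refine ⟨1, ?_⟩
    rw [← hn] at h
    rw [(hr.pow n).right h]
  oreNum a t := (hn.exists_mul_mem t a).choose
  oreDenom _ t := t
  ore_eq a t := (hn.exists_mul_mem t a).choose_spec

end

variable (𝕂 : Type t) [CommRing 𝕂] {A : Type u} [Ring A] [Algebra 𝕂 A]

/-- A ring `B` with an algebra homomorphism `f : A → B` is an `A`-bimodule. -/
noncomputable abbrev bimoduleOfAlgHom {B : Type u} [Ring B] [Algebra 𝕂 B] (f : A →ₐ[𝕂] B) :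
    Module (A ⊗[𝕂] Aᵐᵒᵖ) B :=
  Module.compHom B ((AlgHom.mulLeftRight 𝕂 B).comp
    (Algebra.TensorProduct.map f (AlgHom.op f))).toRingHom

/-- A ring `B` with an algebra homomorphism `f : A → B`, as an object of the category of
`A`-bimodules. -/
noncomputable def bimodule {B : Type u} [Ring B] [Algebra 𝕂 B] (f : A →ₐ[𝕂] B) :
    ModuleCat.{u} (A ⊗[𝕂] Aᵐᵒᵖ) :=
  letI := bimoduleOfAlgHom 𝕂 f
  ModuleCat.of (A ⊗[𝕂] Aᵐᵒᵖ) B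

/-- The bimodule action is `(a ⊗ b) x = f(a) x f(b)`. -/
lemma bimodule_tmul_smul {B : Type u} [Ring B] [Algebra 𝕂 B] (f : A →ₐ[𝕂] B) (a b : A)
    (x : B) : (a ⊗ₜ[𝕂] op b) • (show bimodule 𝕂 f from x) = (f a * x * f b : B) :=
  AlgHom.mulLeftRight_apply 𝕂 B (f a) (op (f b)) x

/-- An algebra homomorphism `f : A → B` as a map of `A`-bimodules. -/
noncomputable def bimoduleMap {B : Type u} [Ring B] [Algebra 𝕂 B] (f : A →ₐ[𝕂] B) :
    bimodule 𝕂 (AlgHom.id 𝕂 A) ⟶ bimodule 𝕂 f :=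
  ModuleCat.ofHom (X := bimodule 𝕂 (AlgHom.id 𝕂 A)) (Y := bimodule 𝕂 f)
    { toFun := fun x => f (show A from x)
      map_add' := fun x y => map_add f (show A from x) (show A from y)
      map_smul' := fun r x => by
        induction r with
        | zero =>
          exact (congrArg f (zero_smul (A ⊗[𝕂] Aᵐᵒᵖ) x)).trans
            ((map_zero f).trans (zero_smul (A ⊗[𝕂] Aᵐᵒᵖ) (show bimodule 𝕂 f from f x)).symm)
        | add r r' h h' =>
          exact (congrArg f (add_smul r r' x)).trans ((map_add f _ _).trans
            ((congrArg₂ _ h h').trans (add_smul r r' (show bimodule 𝕂 f from f x)).symm))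
        | tmul a b =>
          refine (congrArg f (bimodule_tmul_smul 𝕂 (AlgHom.id 𝕂 A) a b.unop x)).trans
            (Eq.trans ?_ (bimodule_tmul_smul 𝕂 f a b.unop (f x)).symm)
          exact (map_mul f _ _).trans (congrArg (· * f b.unop) (map_mul f _ _)) }

/-- The localisation map `A → S⁻¹A` as a homomorphism of algebras. -/
noncomputable def oreLocalizationAlgHom (S : Submonoid A) [OreLocalization.OreSet S] :
    A →ₐ[𝕂] OreLocalization S A :=
  { (OreLocalization.numeratorRingHom : A →+* OreLocalization S A) with
    commutes' := fun _ => rfl }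

/-- The complex of bimodules `K(A; S) = (⋯ → 0 → A → S⁻¹A → 0 → ⋯)` with `A` in degree `0` and
`S⁻¹A` in degree `1`, the differential being the localisation map. -/
noncomputable def localizationComplex (S : Submonoid A) [OreLocalization.OreSet S] :
    CochainComplex (ModuleCat.{u} (A ⊗[𝕂] Aᵐᵒᵖ)) ℤ :=
  HomologicalComplex.double (bimoduleMap 𝕂 (oreLocalizationAlgHom 𝕂 S))
    (show (ComplexShape.up ℤ).Rel 0 1 by simp)

/-- The complex `K(A; s)`, for `s` normal and regular. -/
noncomputable def koszulComplex (s : A) (hn : IsNormalElement s) (hr : IsRegular s) :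
    CochainComplex (ModuleCat.{u} (A ⊗[𝕂] Aᵐᵒᵖ)) ℤ :=
  letI := hn.oreSet hr
  localizationComplex 𝕂 (Submonoid.powers s)

end Koszul

/-! ### The completion functor `Λ_s` -/

section Completion

variable {A : Type u} [Ring A] (s : A)

/-- The submodule generated by the elements `sⁿ m`; it is `sⁿ M` if `s` is normal. -/
def powSMul (M : Type u) [AddCommGroup M] [Module A M] (n : ℕ) : Submodule A M :=
  Submodule.span A (Set.range fun m : M => s ^ n • m)

lemma mem_powSMul {s : A} (hn : IsNormalElement s) {M : Type u} [AddCommGroup M] [Module A M]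
    {n : ℕ} {x : M} : x ∈ powSMul s M n ↔ ∃ m : M, s ^ n • m = x := by
  refine ⟨fun hx => ?_, fun ⟨m, hm⟩ => Submodule.subset_span ⟨m, hm⟩⟩
  induction hx using Submodule.span_induction with
  | mem x h => exact h
  | zero => exact ⟨0, smul_zero _⟩
  | add x y _ _ hx hy =>
    obtain ⟨m, rfl⟩ := hx
    obtain ⟨m', rfl⟩ := hy
    exact ⟨m + m', smul_add _ _ _⟩
  | smul a x _ hx =>
    obtain ⟨m, rfl⟩ := hx
    obtain ⟨b, hb⟩ := hn.exists_mul_pow n a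
    exact ⟨b • m, by rw [smul_smul, smul_smul, hb]⟩

lemma powSMul_antitone (M : Type u) [AddCommGroup M] [Module A M] : Antitone (powSMul s M) := by
  intro m n hmn
  refine Submodule.span_mono ?_
  rintro _ ⟨x, rfl⟩
  exact ⟨s ^ (n - m) • x, by simp only [smul_smul, ← pow_add, Nat.add_sub_cancel' hmn]⟩

/-- The completion `lim M / sⁿ M`: the compatible sequences in `∏ₙ M / sⁿ M`. -/
def completionSubmodule (M : Type u) [AddCommGroup M] [Module A M] :
    Submodule A (∀ n : ℕ, M ⧸ powSMul s M n) where
  carrier := {x | ∀ (m n : ℕ) (h : m ≤ n), Submodule.factor (powSMul_antitone s M h) (x n) = x m}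
  zero_mem' m n h := map_zero _
  add_mem' hx hy m n h := by
    rw [Pi.add_apply, Pi.add_apply, map_add, hx m n h, hy m n h]
  smul_mem' a x hx m n h := by
    rw [Pi.smul_apply, Pi.smul_apply, map_smul, hx m n h]

variable {s} in
lemma powSMul_le_comap {M N : Type u} [AddCommGroup M] [Module A M] [AddCommGroup N] [Module A N]
    (f : M →ₗ[A] N) (n : ℕ) : powSMul s M n ≤ (powSMul s N n).comap f := by
  refine Submodule.span_le.2 ?_
  rintro _ ⟨x, rfl⟩
  exact Submodule.subset_span ⟨f x, (map_smul f _ _).symm⟩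

/-- The map induced on completions by a linear map. -/
def completionMap {M N : Type u} [AddCommGroup M] [Module A M] [AddCommGroup N] [Module A N]
    (f : M →ₗ[A] N) : completionSubmodule s M →ₗ[A] completionSubmodule s N where
  toFun x := ⟨fun n => Submodule.mapQ _ _ f (powSMul_le_comap f n) (x.1 n), fun m n h => by
    have hx := x.2 m n h
    obtain ⟨y, hy⟩ := Submodule.Quotient.mk_surjective _ (x.1 n)
    dsimp only
    rw [← hx, ← hy]
    rfl⟩
  map_add' x y := by
    ext n
    exact map_add (Submodule.mapQ _ _ f (powSMul_le_comap f n)) (x.1 n) (y.1 n)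
  map_smul' a x := by
    ext n
    exact map_smul (Submodule.mapQ _ _ f (powSMul_le_comap f n)) a (x.1 n)

/-- The completion functor `Λ_s : M(A) ⥤ M(A)`, `M ↦ lim M / sⁿ M`. -/
def completionFunctor : ModuleCat.{u} A ⥤ ModuleCat.{u} A where
  obj M := ModuleCat.of A (completionSubmodule s M)
  map f := ModuleCat.ofHom (completionMap s f.hom)
  map_id M := by
    refine ModuleCat.hom_ext (LinearMap.ext fun x => Subtype.ext (funext fun n => ?_))
    exact congrArg (fun g => g (x.1 n)) (Submodule.mapQ_id (powSMul s M n))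
  map_comp {M N P} f g := by
    refine ModuleCat.hom_ext (LinearMap.ext fun x => Subtype.ext (funext fun n => ?_))
    obtain ⟨y, hy⟩ := Submodule.Quotient.mk_surjective _ (x.1 n)
    change Submodule.mapQ _ _ (f ≫ g).hom (powSMul_le_comap _ n) (x.1 n) =
      Submodule.mapQ _ _ g.hom (powSMul_le_comap _ n)
        (Submodule.mapQ _ _ f.hom (powSMul_le_comap _ n) (x.1 n))
    rw [← hy]
    rfl

instance : (completionFunctor s).Additive where
  map_add {M N f g} := by
    refine ModuleCat.hom_ext (LinearMap.ext fun x => Subtype.ext (funext fun n => ?_))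
    obtain ⟨y, hy⟩ := Submodule.Quotient.mk_surjective _ (x.1 n)
    change Submodule.mapQ _ _ (f + g).hom (powSMul_le_comap _ n) (x.1 n) =
      Submodule.mapQ _ _ f.hom (powSMul_le_comap _ n) (x.1 n) +
        Submodule.mapQ _ _ g.hom (powSMul_le_comap _ n) (x.1 n)
    rw [← hy]
    rfl

end Completion

open scoped ModuleCat.Algebra

/-! Since `s` is normal and regular, `A_s` is the increasing union of the sub-bimodules `A s⁻ⁿ`,
each free of rank one as a left module, on `s⁻ⁿ`. This union is the cokernel of the injective map
"identity minus inclusion" on `T = ⨁ A s⁻ⁿ`. Hence `K(A; s)` is resolved by the telescope `E = (A ⊕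
T → T)`, a complex of bimodules in degrees 0 and 1 whose terms are free on the left. It is
K-projective over `A`, so `Hom(E, -)` preserves quasi-isomorphisms and induces a functor on `D(A)`.
The proof shows that this single functor is both derived functors.

For `RHom`: the projection `E → K(A; s)` is a termwise epimorphism whose kernel is `T` in degree 0
and, in degree 1, the isomorphic image of `T` under the telescope map. Precomposition `Hom(K, M) →
Hom(E, M)` is then a quasi-isomorphism as soon as all maps `T → Mⁿ` extend along the telescope map
(`TwoTermKernel.quasiIso_homComplexPrecomp`). Injective modules have this property, and it passes to
quotients because `T` is projective. So every complex has a right resolution, of length one, by such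
modules.

For `LΛ`: let `b_k = (1, -∑_{j<k} 1_j)` in `E⁰`, where `1_j` is the unit in `A s⁻ʲ`. These elements
commute with `A`, and both `b_k - b_{k+1}` and `d b_k` are `sᵏ` times a basis element. Evaluating `g
: E⁰ → M` at all the `b_k` gives a compatible sequence modulo the `sᵏM`, hence an `A`-linear map
`Hom(E⁰, M) → Λ M` that kills the maps factoring through `d`. If `M` has no `s`-torsion, then `0 →
Hom(E¹, M) → Hom(E⁰, M) → Λ M → 0` is exact, whence
`TelescopeBasis.quasiIso_homComplexToCompletion`. Submodules of torsion-free modules are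
torsion-free, as are free modules, so every complex has a left resolution, of length one, by
torsion-free modules.

Invertibility of the unit or counit on enough objects gives the universal property
(`isRightDerivedFunctor_of_exists_isIso`, `isLeftDerivedFunctor_of_exists_isIso`). By uniqueness,
any choice of the two derived functors is isomorphic to the functor induced by `Hom(E, -)`, and the
comparisons inherit compatibility with shifts from the units and counits. -/

namespace CategoryTheory

/-! ### Recognising derived functors from enough objects with invertible unit or counit. -/

section

variable {C D H : Type*} [Category C] [Category D] [Category H] (L : C ⥤ D)
  (W : MorphismProperty C) {F : C ⥤ H} {RF : D ⥤ H}

section Right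

variable (α : F ⟶ L ⋙ RF)

/-- On objects where the unit `α` is invertible, the only possible comparison `RF ⟶ G`. -/
lemma inv_unit_comp_naturality {G : D ⥤ H} (β : F ⟶ L ⋙ G) {X Y : C} (f : X ⟶ Y)
    [IsIso (α.app X)] [IsIso (α.app Y)] :
    (inv (α.app X) ≫ β.app X) ≫ G.map (L.map f) =
      RF.map (L.map f) ≫ inv (α.app Y) ≫ β.app Y := by
  rw [Category.assoc, IsIso.inv_comp_eq]
  have h₁ := α.naturality f
  have h₂ := β.naturality f
  dsimp at h₁ h₂
  rw [← h₂, ← reassoc_of% h₁, IsIso.hom_inv_id_assoc]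

/-- A functor is a right derived functor if its unit is invertible on sufficiently
many objects. -/
lemma isRightDerivedFunctor_of_exists_isIso [L.IsLocalization W] [W.HasLeftCalculusOfFractions]
    (h : ∀ X : C, ∃ (X' : C) (w : X ⟶ X'), W w ∧ IsIso (α.app X')) :
    RF.IsRightDerivedFunctor α W := by
  choose R w hw hα using h
  have hL {X Y : C} (f : X ⟶ Y) (hf : W f) : IsIso (L.map f) := Localization.inverts L W f hf
  have key {G : D ⥤ H} (β : F ⟶ L ⋙ G) {X Y : C} (f : X ⟶ Y) :
      RF.map (L.map f) ≫ RF.map (L.map (w Y)) ≫ (inv (α.app (R Y)) ≫ β.app (R Y)) =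
        RF.map (L.map (w X)) ≫ (inv (α.app (R X)) ≫ β.app (R X)) ≫
          (have := hL _ (hw X); inv (G.map (L.map (w X)))) ≫
          G.map (L.map f) ≫ G.map (L.map (w Y)) := by
    have := hL _ (hw X)
    have := hL _ (hw Y)
    -- The objects `R X` are chosen one by one, so `f` need not lift to a map `R X ⟶ R Y`. The Ore
    -- condition completes the span `w X`, `f ≫ w Y` to a square ending in `φ.Y'`, and `w φ.Y'`
    -- leads on to an object where the unit is invertible, so that naturality applies on both sides.
    obtain ⟨φ, hφ⟩ := (MorphismProperty.RightFraction.mk (w X) (hw X) (f ≫ w Y)).exists_leftFraction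
    dsimp at hφ
    have h₁ : f ≫ w Y ≫ φ.s ≫ w _ = w X ≫ φ.f ≫ w _ := by
      simpa using hφ =≫ w φ.Y'
    have := hL _ (W.comp_mem _ _ φ.hs (hw _))
    rw [← cancel_mono (G.map (L.map (φ.s ≫ w _)))]
    simp only [Category.assoc]
    have e₁ := inv_unit_comp_naturality L α β (φ.s ≫ w _)
    have e₂ := inv_unit_comp_naturality L α β (φ.f ≫ w _)
    simp only [Category.assoc] at e₁ e₂
    rw [e₁]
    simp only [← Functor.map_comp, ← Functor.map_comp_assoc]
    rw [h₁]
    simp only [Functor.map_comp, IsIso.inv_hom_id_assoc]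
    simp only [Functor.map_comp] at e₂
    rw [e₂]
    simp only [Category.assoc]
  have desc {G : D ⥤ H} (β : F ⟶ L ⋙ G) : ∃ γ : RF ⟶ G, α ≫ Functor.whiskerLeft L γ = β := by
    let τ : L ⋙ RF ⟶ L ⋙ G :=
      { app X := RF.map (L.map (w X)) ≫ (inv (α.app (R X)) ≫ β.app (R X)) ≫
          (have := hL _ (hw X); inv (G.map (L.map (w X))))
        naturality X Y f := by
          have := hL _ (hw X)
          have := hL _ (hw Y)
          have h₁ := key β f
          dsimp at h₁ ⊢
          rw [← cancel_mono (G.map (L.map (w Y)))]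
          simp only [Category.assoc, IsIso.inv_hom_id, Category.comp_id] at h₁ ⊢
          exact h₁ }
    refine ⟨Localization.liftNatTrans L W _ _ _ _ τ, ?_⟩
    ext X
    have := hL _ (hw X)
    have h₁ := α.naturality (w X)
    have h₂ := β.naturality (w X)
    dsimp at h₁ h₂ ⊢
    simp only [Localization.liftNatTrans_app]
    dsimp [τ, Localization.Lifting.iso]
    simp only [Category.comp_id, Category.id_comp]
    simp only [Category.assoc]
    rw [← reassoc_of% h₁, IsIso.hom_inv_id_assoc, reassoc_of% h₂, IsIso.hom_inv_id,
      Category.comp_id]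
  have uniq {G : D ⥤ H} (γ γ' : RF ⟶ G) (e : α ≫ Functor.whiskerLeft L γ = α ≫ Functor.whiskerLeft L γ') :
      γ = γ' := by
    apply Localization.natTrans_ext L W
    intro X
    have := hL _ (hw X)
    have h₁ := congr_app e (R X)
    dsimp at h₁
    rw [cancel_epi] at h₁
    rw [← cancel_mono (G.map (L.map (w X))), ← γ.naturality, ← γ'.naturality, h₁]
  refine ⟨⟨⟨Limits.IsInitial.ofUniqueHom (fun G => ?_) (fun G m => ?_)⟩⟩⟩
  · exact StructuredArrow.homMk (desc G.hom).choose (desc G.hom).choose_spec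
  · ext1
    refine uniq _ _ ?_
    have h₁ := StructuredArrow.w m
    exact h₁.trans (desc G.hom).choose_spec.symm

/-- A comparison morphism from a right derived functor whose unit is invertible on sufficiently
many objects is compatible with the shifts if the units are. -/
lemma commShift_of_exists_isIso [L.IsLocalization W] (M : Type*) [AddMonoid M] [HasShift C M]
    [HasShift D M] [HasShift H M] [L.CommShift M] [F.CommShift M] [RF.CommShift M]
    [NatTrans.CommShift α M] {G : D ⥤ H} [G.CommShift M] (γ : RF ⟶ G)
    [NatTrans.CommShift (α ≫ Functor.whiskerLeft L γ) M]
    (h : ∀ X : C, ∃ (X' : C) (w : X ⟶ X'), W w ∧ IsIso (α.app X')) :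
    NatTrans.CommShift γ M where
  shift_comm a := by
    apply Localization.natTrans_ext L W
    intro X
    obtain ⟨X', w, hw, hα⟩ := h X
    have : IsIso (L.map w) := Localization.inverts L W w hw
    have e₁ := NatTrans.shift_app_comm (α ≫ Functor.whiskerLeft L γ) a X'
    have e₂ := NatTrans.shift_app_comm α a X'
    rw [← cancel_mono (G.map (L.map w)⟦a⟧')]
    have n₁ := ((RF.commShiftIso a).hom ≫ Functor.whiskerRight γ (shiftFunctor H a)).naturality (L.map w)
    have n₂ := (Functor.whiskerLeft (shiftFunctor D a) γ ≫ (G.commShiftIso a).hom).naturality (L.map w)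
    refine n₁.symm.trans (Eq.trans ?_ n₂)
    congr 1
    -- Good objects are stable under shift: up to commutation isomorphisms, the unit at `X'⟦a⟧` is
    -- the shift of the unit at `X'`.
    have : IsIso (α.app (X'⟦a⟧)) := by
      have : IsIso (α.app (X'⟦a⟧) ≫ ((L ⋙ RF).commShiftIso a).hom.app X') := by
        rw [← e₂]; infer_instance
      exact IsIso.of_isIso_comp_right _ (((L ⋙ RF).commShiftIso a).hom.app X')
    rw [← cancel_epi (RF.map ((L.commShiftIso a).hom.app X')), ← cancel_epi (α.app (X'⟦a⟧))]
    dsimp at e₁ e₂ ⊢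
    simp only [Functor.map_comp, Functor.commShiftIso_comp_hom_app, Category.assoc] at e₁ e₂ ⊢
    rw [reassoc_of% e₂] at e₁
    rw [e₁, γ.naturality_assoc]

end Right

section Left

variable {LF : D ⥤ H} (α : L ⋙ LF ⟶ F)

/-- On objects where the counit `α` is invertible, the only possible comparison `G ⟶ LF`. -/
lemma comp_inv_counit_naturality {G : D ⥤ H} (β : L ⋙ G ⟶ F) {X Y : C} (f : X ⟶ Y)
    [IsIso (α.app X)] [IsIso (α.app Y)] :
    G.map (L.map f) ≫ β.app Y ≫ inv (α.app Y) =
      (β.app X ≫ inv (α.app X)) ≫ LF.map (L.map f) := by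
  rw [← Category.assoc, IsIso.comp_inv_eq]
  have h₁ := α.naturality f
  have h₂ := β.naturality f
  dsimp at h₁ h₂
  simp only [Category.assoc]
  rw [h₂, h₁, IsIso.inv_hom_id_assoc]

/-- A functor is a left derived functor if its counit is invertible on sufficiently
many objects. -/
lemma isLeftDerivedFunctor_of_exists_isIso [L.IsLocalization W] [W.HasRightCalculusOfFractions]
    (h : ∀ X : C, ∃ (X' : C) (w : X' ⟶ X), W w ∧ IsIso (α.app X')) :
    LF.IsLeftDerivedFunctor α W := by
  choose R w hw hα using h
  have hL {X Y : C} (f : X ⟶ Y) (hf : W f) : IsIso (L.map f) := Localization.inverts L W f hf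
  have key {G : D ⥤ H} (β : L ⋙ G ⟶ F) {X Y : C} (f : X ⟶ Y) :
      (β.app (R X) ≫ inv (α.app (R X))) ≫ LF.map (L.map (w X)) ≫ LF.map (L.map f) =
        G.map (L.map (w X)) ≫ G.map (L.map f) ≫
          (have := hL _ (hw Y); inv (G.map (L.map (w Y)))) ≫
          (β.app (R Y) ≫ inv (α.app (R Y))) ≫ LF.map (L.map (w Y)) := by
    have := hL _ (hw X)
    have := hL _ (hw Y)
    -- As for right derived functors, with the cospan `w X ≫ f`, `w Y` completed to a square on the
    -- left.
    obtain ⟨φ, hφ⟩ := (MorphismProperty.LeftFraction.mk (w X ≫ f) (w Y) (hw Y)).exists_rightFraction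
    dsimp at hφ
    have h₁ : w _ ≫ φ.s ≫ w X ≫ f = w φ.X' ≫ φ.f ≫ w Y := by
      simpa using w φ.X' ≫= hφ
    have := hL _ (W.comp_mem _ _ (hw _) φ.hs)
    rw [← cancel_epi (G.map (L.map (w _ ≫ φ.s)))]
    have e₁ := comp_inv_counit_naturality L α β (w _ ≫ φ.s)
    have e₂ := comp_inv_counit_naturality L α β (w _ ≫ φ.f)
    simp only [Category.assoc] at e₁ e₂ ⊢
    rw [reassoc_of% e₁]
    simp only [← Functor.map_comp, ← Functor.map_comp_assoc, Category.assoc]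
    rw [h₁]
    simp only [Functor.map_comp, Category.assoc, IsIso.hom_inv_id_assoc]
    simp only [Functor.map_comp, Category.assoc] at e₂
    rw [reassoc_of% e₂]
  have lift {G : D ⥤ H} (β : L ⋙ G ⟶ F) : ∃ γ : G ⟶ LF, Functor.whiskerLeft L γ ≫ α = β := by
    let τ : L ⋙ G ⟶ L ⋙ LF :=
      { app X := (have := hL _ (hw X); inv (G.map (L.map (w X)))) ≫
          (β.app (R X) ≫ inv (α.app (R X))) ≫ LF.map (L.map (w X))
        naturality X Y f := by
          have := hL _ (hw X)
          have := hL _ (hw Y)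
          have h₁ := key β f
          dsimp at h₁ ⊢
          rw [← cancel_epi (G.map (L.map (w X)))]
          simp only [Category.assoc, IsIso.hom_inv_id_assoc] at h₁ ⊢
          exact h₁.symm }
    refine ⟨Localization.liftNatTrans L W _ _ _ _ τ, ?_⟩
    ext X
    have := hL _ (hw X)
    have h₁ := α.naturality (w X)
    have h₂ := β.naturality (w X)
    dsimp at h₁ h₂ ⊢
    simp only [Localization.liftNatTrans_app]
    dsimp [τ, Localization.Lifting.iso]
    simp only [Category.comp_id, Category.id_comp, Category.assoc]
    rw [h₁, IsIso.inv_hom_id_assoc, ← h₂, IsIso.inv_hom_id_assoc]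
  have uniq {G : D ⥤ H} (γ γ' : G ⟶ LF)
      (e : Functor.whiskerLeft L γ ≫ α = Functor.whiskerLeft L γ' ≫ α) : γ = γ' := by
    apply Localization.natTrans_ext L W
    intro X
    have := hL _ (hw X)
    have h₁ := congr_app e (R X)
    dsimp at h₁
    rw [cancel_mono] at h₁
    rw [← cancel_epi (G.map (L.map (w X))), γ.naturality, γ'.naturality, h₁]
  refine ⟨⟨⟨Limits.IsTerminal.ofUniqueHom (fun G => ?_) (fun G m => ?_)⟩⟩⟩
  · exact CostructuredArrow.homMk (lift G.hom).choose (lift G.hom).choose_spec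
  · ext1
    refine uniq _ _ ?_
    have h₁ := CostructuredArrow.w m
    exact h₁.trans (lift G.hom).choose_spec.symm

/-- A comparison morphism to a left derived functor whose counit is invertible on sufficiently
many objects is compatible with the shifts if the counits are. -/
lemma commShift_of_exists_isIso' [L.IsLocalization W] (M : Type*) [AddMonoid M] [HasShift C M]
    [HasShift D M] [HasShift H M] [L.CommShift M] [F.CommShift M] [LF.CommShift M]
    [NatTrans.CommShift α M] {G : D ⥤ H} [G.CommShift M] (γ : G ⟶ LF)
    [NatTrans.CommShift (Functor.whiskerLeft L γ ≫ α) M]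
    (h : ∀ X : C, ∃ (X' : C) (w : X' ⟶ X), W w ∧ IsIso (α.app X')) :
    NatTrans.CommShift γ M where
  shift_comm a := by
    apply Localization.natTrans_ext L W
    intro X
    obtain ⟨X', w, hw, hα⟩ := h X
    have : IsIso (L.map w) := Localization.inverts L W w hw
    have e₁ := NatTrans.shift_app_comm (Functor.whiskerLeft L γ ≫ α) a X'
    have e₂ := NatTrans.shift_app_comm α a X'
    rw [← cancel_epi (G.map ((L.map w)⟦a⟧'))]
    have n₁ := ((G.commShiftIso a).hom ≫
      Functor.whiskerRight γ (shiftFunctor H a)).naturality (L.map w)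
    have n₂ := (Functor.whiskerLeft (shiftFunctor D a) γ ≫
      (LF.commShiftIso a).hom).naturality (L.map w)
    refine n₁.trans (Eq.trans ?_ n₂.symm)
    congr 1
    rw [← cancel_mono ((α.app X')⟦a⟧'), ← cancel_epi (G.map ((L.commShiftIso a).hom.app X'))]
    dsimp at e₁ e₂ ⊢
    simp only [Functor.map_comp, Functor.commShiftIso_comp_hom_app, Category.assoc] at e₁ e₂ ⊢
    rw [e₁, ← e₂, γ.naturality_assoc]

end Left

end

end CategoryTheory

/-! ### K-projective complexes and an elementwise test for quasi-isomorphisms. -/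

namespace CochainComplex

open HomComplex

section

variable {C : Type*} [Category C] [Abelian C]

lemma quasiIso_iff_acyclic_mappingCone {K L : CochainComplex C ℤ} (φ : K ⟶ L) :
    QuasiIso φ ↔ (mappingCone φ).Acyclic := by
  rw [← HomotopyCategory.quotient_obj_mem_subcategoryAcyclic_iff_acyclic,
    ← HomologicalComplex.mem_quasiIso_iff, ← HomotopyCategory.quotient_map_mem_quasiIso_iff,
    HomotopyCategory.quasiIso_eq_trW_subcategoryAcyclic]
  exact ObjectProperty.trW_iff_of_distinguished _ _
    (HomotopyCategory.mappingCone_triangleh_distinguished φ)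

/-- A cocycle of degree `n` is a morphism `P ⟶ N⟦n⟧`. As `N⟦n⟧` is acyclic, this morphism is
null-homotopic, and a null-homotopy is a primitive of the cocycle. -/
lemma IsKProjective.exists_δ_eq (P : CochainComplex C ℤ) [P.IsKProjective]
    {N : CochainComplex C ℤ} (hN : N.Acyclic) (n m : ℤ) (hnm : m + 1 = n) (z : Cochain P N n)
    (hz : δ n (n + 1) z = 0) : ∃ y : Cochain P N m, δ m n y = z := by
  have hN' : HomotopyCategory.subcategoryAcyclic C
      ((HomotopyCategory.quotient C (ComplexShape.up ℤ)).obj (N⟦n⟧)) := by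
    refine ObjectProperty.prop_of_iso _
      (((HomotopyCategory.quotient C (.up ℤ)).commShiftIso n).symm.app N) ?_
    refine (HomotopyCategory.subcategoryAcyclic C).le_shift n _ ?_
    rwa [HomotopyCategory.quotient_obj_mem_subcategoryAcyclic_iff_acyclic]
  let z' : Cocycle P N n := ⟨z, by rwa [Cocycle.mem_iff _ _ rfl]⟩
  have h := IsKProjective.leftOrthogonal P (CohomologyClass.toHom (CohomologyClass.mk z')) hN'
  rw [CohomologyClass.toHom_mk_eq_zero_iff, mem_coboundaries_iff _ m hnm] at h
  exact h

/-- For `P` K-projective, `Hom(P, -)` preserves quasi-isomorphisms. -/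
lemma IsKProjective.exists_of_quasiIso (P : CochainComplex C ℤ) [P.IsKProjective]
    {M N : CochainComplex C ℤ} (f : M ⟶ N) [hf : QuasiIso f] (n m : ℤ) (hnm : m + 1 = n)
    (x : Cochain P M (n + 1)) (y : Cochain P N n) (hx : δ (n + 1) (n + 1 + 1) x = 0)
    (hy : x.comp (Cochain.ofHom f) (add_zero _) = δ n (n + 1) y) :
    ∃ (x' : Cochain P M n) (y' : Cochain P N m),
      δ n (n + 1) x' = x ∧ x'.comp (Cochain.ofHom f) (add_zero _) + δ m n y' = y := by
  rw [quasiIso_iff_acyclic_mappingCone] at hf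
  -- The pair `(x, -y)` is a cocycle with values in the cone of `f`, which is acyclic. The
  -- components of a primitive of it are `-x'` and `-y'`.
  obtain ⟨w, hw⟩ := exists_δ_eq P hf n m hnm (mappingCone.liftCochain f x (-y) rfl) (by
    rw [mappingCone.δ_liftCochain _ _ _ _ _ rfl, hx, hy]
    simp)
  obtain ⟨α, β, rfl⟩ : ∃ (α : Cochain P M n) (β : Cochain P N m),
      w = mappingCone.liftCochain f α β hnm := by
    refine ⟨w.comp (mappingCone.fst f).1 hnm, w.comp (mappingCone.snd f) (add_zero m), ?_⟩
    rw [mappingCone.ext_cochain_to_iff _ _ _ hnm]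
    simp
  refine ⟨-α, -β, ?_, ?_⟩
  · have := congrArg (fun z => z.comp (mappingCone.fst f).1 rfl) hw
    simpa [mappingCone.δ_liftCochain _ _ _ _ _ rfl, Cochain.comp_assoc_of_second_degree_eq_neg_third_degree] using this
  · have := congrArg (fun z => z.comp (mappingCone.snd f) (add_zero n)) hw
    simp [mappingCone.δ_liftCochain _ _ _ _ _ rfl] at this
    simp
    rw [← neg_add, add_comm, this, neg_neg]

end

variable {A : Type u} [Ring A]

lemma hom_apply_congr {M N : ModuleCat.{u} A} {f g : M ⟶ N} (h : f = g) (x : M) :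
    f.hom x = g.hom x := by rw [h]

/-- An elementwise criterion for quasi-isomorphisms: the mapping cone is exact. -/
lemma quasiIso_of_forall_exists {K L : CochainComplex (ModuleCat.{u} A) ℤ} (φ : K ⟶ L)
    (h : ∀ (n : ℤ) (x : K.X (n + 1)) (y : L.X n), (K.d (n + 1) (n + 1 + 1)).hom x = 0 →
      (φ.f (n + 1)).hom x = (L.d n (n + 1)).hom y →
      ∃ (x' : K.X n) (y' : L.X (n - 1)), (K.d n (n + 1)).hom x' = x ∧
        (φ.f n).hom x' + (L.d (n - 1) n).hom y' = y) : QuasiIso φ := by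
  rw [quasiIso_iff_acyclic_mappingCone]
  intro n
  rw [HomologicalComplex.exactAt_iff' _ (n - 1) n (n + 1) (by simp) (by simp),
    ShortComplex.moduleCat_exact_iff]
  intro (w : (mappingCone φ).X n) (hw : ((mappingCone φ).d n (n + 1)).hom w = 0)
  change ∃ v : (mappingCone φ).X (n - 1), ((mappingCone φ).d (n - 1) n).hom v = w
  let x : K.X (n + 1) := ((mappingCone.fst φ).1.v n (n + 1) rfl).hom w
  let y : L.X n := ((mappingCone.snd φ).v n n (add_zero n)).hom w
  have hwd : ((mappingCone.inl φ).v (n + 1) n (by lia)).hom x +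
      ((mappingCone.inr φ).f n).hom y = w :=
    hom_apply_congr (mappingCone.id_X φ n (n + 1) rfl) w
  have hx : (K.d (n + 1) (n + 1 + 1)).hom x = 0 := by
    have h₁ : ((mappingCone.fst φ).1.v _ _ rfl).hom (((mappingCone φ).d n (n + 1)).hom w) =
        -((K.d (n + 1) (n + 1 + 1)).hom x) :=
      hom_apply_congr (mappingCone.d_fst_v φ n (n + 1) (n + 1 + 1) rfl rfl) w
    rw [hw, map_zero] at h₁
    exact neg_eq_zero.1 h₁.symm
  have hy : (φ.f (n + 1)).hom x + (L.d n (n + 1)).hom y = 0 := by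
    have h₁ : ((mappingCone.snd φ).v _ _ (add_zero _)).hom
        (((mappingCone φ).d n (n + 1)).hom w) =
        (φ.f (n + 1)).hom x + (L.d n (n + 1)).hom y :=
      hom_apply_congr (mappingCone.d_snd_v φ n (n + 1) rfl) w
    rw [hw, map_zero] at h₁
    exact h₁.symm
  obtain ⟨x', y', hx', hy'⟩ := h n x (-y) hx (by rw [map_neg]; exact eq_neg_of_add_eq_zero_left hy)
  refine ⟨-((mappingCone.inl φ).v n (n - 1) (by lia)).hom x' -
    ((mappingCone.inr φ).f (n - 1)).hom y', ?_⟩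
  have e₁ : ((mappingCone φ).d (n - 1) n).hom (((mappingCone.inl φ).v n (n - 1) (by lia)).hom x') =
      ((mappingCone.inr φ).f n).hom ((φ.f n).hom x') -
      ((mappingCone.inl φ).v (n + 1) n (by lia)).hom ((K.d n (n + 1)).hom x') :=
    hom_apply_congr (mappingCone.inl_v_d φ n (n - 1) (n + 1) (by lia) (by lia)) x'
  have e₂ : ((mappingCone φ).d (n - 1) n).hom (((mappingCone.inr φ).f (n - 1)).hom y') =
      ((mappingCone.inr φ).f n).hom ((L.d (n - 1) n).hom y') :=
    hom_apply_congr (mappingCone.inr_f_d φ (n - 1) n) y'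
  rw [map_sub, map_neg, e₂, e₁, ← hwd, hx',
    show y = -((φ.f n).hom x' + (L.d (n - 1) n).hom y') by rw [hy', neg_neg], map_neg, map_add]
  abel

end CochainComplex

/-! ### Resolutions of length one of unbounded complexes. -/

namespace CochainComplex

open HomComplex Limits

section

variable {C : Type*} [Category C] [Abelian C]

lemma prop_mappingCone_X {P : ObjectProperty C} [P.IsClosedUnderIsomorphisms]
    (hP : ∀ X Y, P X → P Y → P (X ⊞ Y)) {K L : CochainComplex C ℤ} (φ : K ⟶ L)
    (hK : ∀ n, P (K.X n)) (hL : ∀ n, P (L.X n)) (n : ℤ) : P ((mappingCone φ).X n) :=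
  P.prop_of_iso (HomologicalComplex.homotopyCofiber.XIsoBiprod φ n (n + 1) rfl).symm
    (hP _ _ (hK _) (hL _))

/-- The complex with given objects and zero differentials. -/
def gradedObject (X : ℤ → C) : CochainComplex C ℤ where
  X := X
  d _ _ := 0

/-- For `X` with zero differential, an arbitrary cochain `X → M` of degree `-1` extends uniquely to
a map of complexes from the cone of `𝟙 X` to `M`. Taking for `Xⁿ` a cover of `Mⁿ⁻¹` makes this map
epi in each degree. -/
lemma exists_epi_of_forall_exists_epi {P : ObjectProperty C} [P.IsClosedUnderIsomorphisms]
    (hP : ∀ X Y, P X → P Y → P (X ⊞ Y)) (h : ∀ X : C, ∃ (Y : C) (p : Y ⟶ X), P Y ∧ Epi p)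
    (M : CochainComplex C ℤ) :
    ∃ (F : CochainComplex C ℤ) (p : F ⟶ M), (∀ n, P (F.X n)) ∧ Epi p := by
  choose Y p hY hp using h
  let X : CochainComplex C ℤ := gradedObject (fun n => Y (M.X (n + (-1))))
  let α : Cochain X M (-1) := Cochain.mk fun n m h => p (M.X (n + (-1))) ≫ (M.XIsoOfEq h).hom
  let β : X ⟶ M := Cocycle.homOf (Cocycle.mk (δ (-1) 0 α) 1 rfl (δ_δ _ _ _ _))
  let f : mappingCone (𝟙 X) ⟶ M := mappingCone.desc (𝟙 X) α β (by simp [β])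
  refine ⟨_, f, prop_mappingCone_X hP _ (fun n => hY _) (fun n => hY _), ?_⟩
  have (n : ℤ) : Epi (f.f n) := by
    have h₁ : (mappingCone.inl (𝟙 X)).v (n + 1) n (by lia) ≫ f.f n = α.v (n + 1) n (by lia) := by
      simp [f]
    have : Epi (α.v (n + 1) n (by lia)) := by
      have := hp (M.X (n + 1 + (-1)))
      exact epi_comp (p (M.X (n + 1 + (-1)))) _
    exact epi_of_epi_fac h₁
  exact HomologicalComplex.epi_of_epi_f f this

/-- Dually, a cochain of degree `0` from `M` to a graded object `X` determines a map to the cone of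
`𝟙 X`, here one that is mono in each degree. -/
lemma exists_mono_of_forall_exists_mono {P : ObjectProperty C} [P.IsClosedUnderIsomorphisms]
    (hP : ∀ X Y, P X → P Y → P (X ⊞ Y)) (h : ∀ X : C, ∃ (Y : C) (i : X ⟶ Y), P Y ∧ Mono i)
    (M : CochainComplex C ℤ) :
    ∃ (F : CochainComplex C ℤ) (i : M ⟶ F), (∀ n, P (F.X n)) ∧ Mono i := by
  choose Y i hY hi using h
  let X : CochainComplex C ℤ := gradedObject (fun n => Y (M.X n))
  let β : Cochain M X 0 := Cochain.ofHoms fun n => i (M.X n)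
  let α : Cocycle M X 1 := Cocycle.mk (-δ 0 1 β) 2 rfl (by rw [δ_neg, δ_δ, neg_zero])
  let f : M ⟶ mappingCone (𝟙 X) := mappingCone.lift (𝟙 X) α β (by simp [α])
  refine ⟨_, f, prop_mappingCone_X hP _ (fun n => hY _) (fun n => hY _), ?_⟩
  have (n : ℤ) : Mono (f.f n) := by
    have h₁ : f.f n ≫ (mappingCone.snd (𝟙 X)).v n n (add_zero n) = i (M.X n) := by
      rw [mappingCone.lift_f_snd_v]
      exact Cochain.ofHoms_v _ _
    have : Mono (show M.X n ⟶ X.X n from i (M.X n)) := hi (M.X n)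
    exact mono_of_mono_fac h₁
  exact HomologicalComplex.mono_of_mono_f f this

/-- Left resolutions of length one by objects satisfying a property stable under subobjects. -/
lemma exists_quasiIso_of_isClosedUnderSubobjects {P : ObjectProperty C}
    [P.IsClosedUnderSubobjects]
    (hP : ∀ X Y, P X → P Y → P (X ⊞ Y)) (h : ∀ X : C, ∃ (Y : C) (p : Y ⟶ X), P Y ∧ Epi p)
    (M : CochainComplex C ℤ) :
    ∃ (N : CochainComplex C ℤ) (f : N ⟶ M), (∀ n, P (N.X n)) ∧ QuasiIso f := by
  obtain ⟨F, p, hF, _⟩ := exists_epi_of_forall_exists_epi hP h M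
  let S : ShortComplex (CochainComplex C ℤ) := ShortComplex.mk (kernel.ι p) p (by simp)
  have hS : S.ShortExact := { exact := ShortComplex.exact_kernel p }
  refine ⟨_, mappingCone.descShortComplex S, prop_mappingCone_X hP _ (fun n => ?_) hF,
    mappingCone.quasiIso_descShortComplex hS⟩
  exact P.prop_of_mono ((kernel.ι p).f n) (hF n)

end

variable {A : Type u} [Ring A]

/-- This yields the second component of the differential of the cocone. The second projection is
`descCochain` of zero and the identity, whose coboundary is known. -/
lemma mappingCocone_δ_snd {C : Type*} [Category C] [Abelian C] {K L : CochainComplex C ℤ}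
    (φ : K ⟶ L) : δ (-1) 0 (mappingCocone.snd φ) +
      Cochain.ofHom (mappingCocone.fst φ ≫ φ) = 0 := by
  have h : mappingCocone.descCochain φ (m := -1) (n := 0) 0 (Cochain.ofHom (𝟙 L)) (by lia) =
      mappingCocone.snd φ := by
    ext p q hpq
    rw [← Category.id_comp (Cochain.v _ p q hpq), ← Category.id_comp (Cochain.v _ p q hpq),
      ← mappingCocone.id_X φ p q hpq]
    simp [mappingCocone.inr_v_descCochain_v _ _ _ _ _ _ _ _ hpq]
  rw [← h, mappingCocone.δ_descCochain _ _ _ _ 1 (by lia)]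
  simp

/-- The morphism to the mapping cocone attached to a short exact sequence of complexes
is a quasi-isomorphism. -/
lemma quasiIso_mappingCocone_lift {S : ShortComplex (CochainComplex (ModuleCat.{u} A) ℤ)}
    (hS : S.ShortExact) :
    QuasiIso (mappingCocone.lift S.g S.f 0 (by simp)) := by
  set φ := mappingCocone.lift S.g S.f 0 (by simp) with hφ
  have hSn (n : ℤ) := hS.map_of_exact (HomologicalComplex.eval _ _ n)
  have inj (n : ℤ) : Function.Injective (S.f.f n).hom := (hSn n).moduleCat_injective_f
  have surj (n : ℤ) : Function.Surjective (S.g.f n).hom := (hSn n).moduleCat_surjective_g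
  have exact (n : ℤ) : ∀ y, (S.g.f n).hom y = 0 → ∃ x, (S.f.f n).hom x = y :=
    ((ShortComplex.moduleCat_exact_iff _).1 (hSn n).exact)
  have hfst (n : ℤ) (x) : ((mappingCocone.fst S.g).f n).hom ((φ.f n).hom x) = (S.f.f n).hom x :=
    hom_apply_congr (mappingCocone.lift_f_fst_f S.g S.f 0 (by simp) n) x
  have hsnd (n m : ℤ) (h : n + (-1) = m) (x) : ((mappingCocone.snd S.g).v n m h).hom
      ((φ.f n).hom x) = 0 :=
    hom_apply_congr (mappingCocone.lift_f_snd_v S.g S.f 0 (by simp) n m h) x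
  have ext' (n m : ℤ) (h : n + (-1) = m) (a b : (mappingCocone S.g).X n)
      (h₁ : ((mappingCocone.fst S.g).f n).hom a = ((mappingCocone.fst S.g).f n).hom b)
      (h₂ : ((mappingCocone.snd S.g).v n m h).hom a = ((mappingCocone.snd S.g).v n m h).hom b) :
      a = b := by
    have ha := hom_apply_congr (mappingCocone.id_X S.g n m h) a
    have hb := hom_apply_congr (mappingCocone.id_X S.g n m h) b
    refine ha.symm.trans (Eq.trans ?_ hb)
    simp [h₁, h₂]
  have fstd (n m : ℤ) (z) : ((mappingCocone.fst S.g).f m).hom (((mappingCocone S.g).d n m).hom z) =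
      (S.X₂.d n m).hom (((mappingCocone.fst S.g).f n).hom z) :=
    hom_apply_congr ((mappingCocone.fst S.g).comm n m).symm z
  have sndd (n m : ℤ) (h : n + 1 = m) (z) : ((mappingCocone.snd S.g).v m n (by omega)).hom
      (((mappingCocone S.g).d n m).hom z) =
        -(S.X₃.d (n - 1) n).hom (((mappingCocone.snd S.g).v n (n - 1) (by omega)).hom z) -
          (S.g.f n).hom (((mappingCocone.fst S.g).f n).hom z) := by
    have h₁ := Cochain.congr_v (mappingCocone_δ_snd S.g) n n (add_zero n)
    rw [Cochain.add_v, δ_v (-1) 0 (by omega) _ n n _ (n - 1) m (by omega) h] at h₁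
    have h₂ := hom_apply_congr h₁ z
    simp at h₂
    rw [← sub_eq_zero, ← h₂]
    abel
  refine quasiIso_of_forall_exists _ (fun n x z _ hz => ?_)
  -- Adding to `z` the boundary of the element `w` given by `v` removes its second component. The
  -- first component is then killed by `S.g`, so it comes from an element `x'` of `S.X₁`.
  obtain ⟨v, hv⟩ := surj (n - 1) (((mappingCocone.snd S.g).v n (n - 1) (by omega)).hom z)
  let w : (mappingCocone S.g).X (n - 1) :=
    ((mappingCocone.inl S.g).v (n - 1) (n - 1) (add_zero _)).hom v
  have hw₁ : ((mappingCocone.fst S.g).f (n - 1)).hom w = v :=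
    hom_apply_congr (mappingCocone.inl_v_fst_f S.g (n - 1)) v
  have hw₂ : ((mappingCocone.snd S.g).v (n - 1) (n - 1 - 1) (by omega)).hom w = 0 :=
    hom_apply_congr (mappingCocone.inl_v_snd_v S.g (n - 1) (n - 1 - 1) (by omega)) v
  obtain ⟨x', hx'⟩ := exact n (((mappingCocone.fst S.g).f n).hom z + (S.X₂.d (n - 1) n).hom v) (by
    have h₁ := sndd n (n + 1) rfl z
    rw [← hz, hsnd, ← hv] at h₁
    have h₂ : (S.g.f n).hom ((S.X₂.d (n - 1) n).hom v) =
      (S.X₃.d (n - 1) n).hom ((S.g.f (n - 1)).hom v) :=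
      hom_apply_congr (S.g.comm (n - 1) n).symm v
    rw [map_add, h₂, ← neg_eq_zero, h₁]
    abel)
  refine ⟨x', -w, inj _ ?_, ext' n (n - 1) (by omega) _ _ ?_ ?_⟩
  · have h₁ : (S.f.f (n + 1)).hom ((S.X₁.d n (n + 1)).hom x') =
      (S.X₂.d n (n + 1)).hom ((S.f.f n).hom x') :=
      hom_apply_congr (S.f.comm n (n + 1)).symm x'
    have h₂ : (S.X₂.d n (n + 1)).hom ((S.X₂.d (n - 1) n).hom v) = 0 :=
      hom_apply_congr (S.X₂.d_comp_d _ _ _) v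
    rw [h₁, hx', map_add, h₂, add_zero, ← fstd, ← hz, hfst]
  · rw [map_add, hfst, map_neg, map_neg, fstd, hw₁, hx']
    abel
  · rw [map_add, hsnd, map_neg, map_neg, sndd _ _ (by omega), hw₁, hw₂, hv]
    simp

/-- Right resolutions of length one by modules satisfying a property stable under quotients. -/
lemma exists_quasiIso_of_isClosedUnderQuotients {P : ObjectProperty (ModuleCat.{u} A)}
    [P.IsClosedUnderQuotients]
    (hP : ∀ X Y, P X → P Y → P (X ⊞ Y))
    (h : ∀ X : ModuleCat.{u} A, ∃ (Y : ModuleCat.{u} A) (i : X ⟶ Y), P Y ∧ Mono i)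
    (M : CochainComplex (ModuleCat.{u} A) ℤ) :
    ∃ (N : CochainComplex (ModuleCat.{u} A) ℤ) (f : M ⟶ N), (∀ n, P (N.X n)) ∧ QuasiIso f := by
  obtain ⟨F, i, hF, _⟩ := exists_mono_of_forall_exists_mono hP h M
  let S : ShortComplex (CochainComplex (ModuleCat.{u} A) ℤ) :=
    ShortComplex.mk i (cokernel.π i) (by simp)
  have hS : S.ShortExact := { exact := ShortComplex.exact_cokernel i }
  exact ⟨_, mappingCocone.lift S.g S.f 0 (by simp), fun n => prop_mappingCone_X hP S.g hF
    (fun n => P.prop_of_epi ((cokernel.π i).f n) (hF n)) (n + -1), quasiIso_mappingCocone_lift hS⟩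

end CochainComplex

/-! ### Free families, by their universal property. -/

section FreeFamily

variable {A : Type u} [Ring A]

/-- A family of elements of a module is free if linear maps from the module are uniquely
determined by arbitrary values on it. -/
def IsFreeFamily {I : Type*} (V : ModuleCat.{u} A) (v : I → V) : Prop :=
  ∀ (M : ModuleCat.{u} A) (m : I → M), ∃! h : V ⟶ M, ∀ i, h.hom (v i) = m i

namespace IsFreeFamily

variable {I : Type*} {V : ModuleCat.{u} A} {v : I → V} (hv : IsFreeFamily V v)

include hv

lemma exists_hom {M : ModuleCat.{u} A} (m : I → M) : ∃ h : V ⟶ M, ∀ i, h.hom (v i) = m i :=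
  (hv M m).exists

lemma hom_ext {M : ModuleCat.{u} A} {g h : V ⟶ M} (e : ∀ i, g.hom (v i) = h.hom (v i)) : g = h :=
  (hv M _).unique e (fun _ => rfl)

lemma of_iso {V' : ModuleCat.{u} A} (e : V ≅ V') : IsFreeFamily V' (fun i => e.hom.hom (v i)) := by
  intro M m
  obtain ⟨h, hh⟩ := hv.exists_hom m
  refine ⟨e.inv ≫ h, fun i => ?_, fun g hg => ?_⟩
  · simpa using hh i
  · rw [← cancel_epi e.hom, e.hom_inv_id_assoc]
    exact hv.hom_ext fun i => (hg i).trans (hh i).symm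

lemma projective : Projective V where
  factors {M N} f e _ := by
    have he : Function.Surjective e.hom := (ModuleCat.epi_iff_surjective e).1 inferInstance
    obtain ⟨h, hh⟩ := hv.exists_hom (fun i => (he (f.hom (v i))).choose)
    refine ⟨h, hv.hom_ext fun i => ?_⟩
    exact (congrArg e.hom (hh i)).trans (he (f.hom (v i))).choose_spec

end IsFreeFamily

end FreeFamily

/-! ### The bimodules `A s⁻ⁿ`, and their union as a cokernel. -/

section Bimodule

open MulOpposite

variable {𝕂 : Type t} [CommRing 𝕂] {A : Type u} [Ring A] [Algebra 𝕂 A]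
  {B : Type u} [Ring B] [Algebra 𝕂 B] (f : A →ₐ[𝕂] B)

/-- The underlying ring of the bimodule attached to an algebra homomorphism. -/
def bimoduleAddEquiv : bimodule 𝕂 f ≃+ B := AddEquiv.refl B

lemma bimoduleAddEquiv_smul (a b : A) (x : bimodule 𝕂 f) :
    bimoduleAddEquiv f ((a ⊗ₜ[𝕂] op b) • x) = f a * bimoduleAddEquiv f x * f b :=
  bimodule_tmul_smul 𝕂 f a b x

lemma bimoduleAddEquiv_bimoduleMap (x : bimodule 𝕂 (AlgHom.id 𝕂 A)) :
    bimoduleAddEquiv f ((bimoduleMap 𝕂 f).hom x) = f (bimoduleAddEquiv (AlgHom.id 𝕂 A) x) := rfl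

variable {s : A} (hn : IsNormalElement s)

/-- The sub-bimodule `A s⁻ⁿ` of a ring in which `s` is invertible. -/
def fractionSubmodule (n : ℕ) : Submodule (A ⊗[𝕂] Aᵐᵒᵖ) (bimodule 𝕂 f) where
  carrier := {x | ∃ a : A, bimoduleAddEquiv f x * f s ^ n = f a}
  zero_mem' := ⟨0, by simp⟩
  add_mem' := by
    rintro x y ⟨a, ha⟩ ⟨b, hb⟩
    exact ⟨a + b, by rw [map_add, add_mul, ha, hb, map_add]⟩
  smul_mem' := by
    rintro r x ⟨a, ha⟩
    induction r with
    | zero =>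
      have h : bimoduleAddEquiv f ((0 : A ⊗[𝕂] Aᵐᵒᵖ) • x) = 0 :=
        (congrArg _ (zero_smul (A ⊗[𝕂] Aᵐᵒᵖ) x)).trans (map_zero _)
      exact ⟨0, (congrArg (· * f s ^ n) h).trans (by rw [zero_mul, map_zero])⟩
    | add r r' h h' =>
      obtain ⟨b, hb⟩ := h
      obtain ⟨b', hb'⟩ := h'
      exact ⟨b + b', by rw [add_smul, map_add, add_mul, hb, hb', map_add]⟩
    | tmul c d =>
      obtain ⟨d, rfl⟩ := op_surjective d
      -- Normality moves the right multiplier `d` past `s ^ n`, which is why `A s⁻ⁿ` is stable under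
      -- the right action.
      obtain ⟨d', hd'⟩ := hn.exists_mul_pow n d
      refine ⟨c * a * d', ?_⟩
      have := congrArg f hd'
      rw [map_mul, map_pow, map_mul, map_pow] at this
      rw [bimoduleAddEquiv_smul, mul_assoc _ (f d), this, map_mul, map_mul, ← ha]
      noncomm_ring

lemma fractionSubmodule_monotone : Monotone (fractionSubmodule f hn) := by
  refine monotone_nat_of_le_succ fun n x ⟨a, ha⟩ => ⟨a * s, ?_⟩
  rw [pow_succ, ← mul_assoc, ha, map_mul]

/-- The direct sum of the bimodules `A s⁻ⁿ`. -/
abbrev fractionSum : Type u := DirectSum ℕ fun n => fractionSubmodule f hn n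

/-- The inclusion of `A s⁻ⁿ` in the direct sum. -/
noncomputable abbrev fractionSum.incl (n : ℕ) :
    fractionSubmodule f hn n →ₗ[A ⊗[𝕂] Aᵐᵒᵖ] fractionSum f hn :=
  DirectSum.lof (A ⊗[𝕂] Aᵐᵒᵖ) ℕ (fun n => fractionSubmodule f hn n) n

/-- The map `⨁ A s⁻ⁿ → ⨁ A s⁻ⁿ` given by the difference between the identity and the inclusions
`A s⁻ⁿ → A s⁻ⁿ⁻¹`. -/
noncomputable def telescopeMap :
    fractionSum f hn →ₗ[A ⊗[𝕂] Aᵐᵒᵖ] fractionSum f hn :=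
  DirectSum.toModule _ ℕ _ fun n => fractionSum.incl f hn n -
    fractionSum.incl f hn (n + 1) ∘ₗ
      Submodule.inclusion (fractionSubmodule_monotone f hn n.le_succ)

lemma telescopeMap_incl (n : ℕ) (x : fractionSubmodule f hn n) :
    telescopeMap f hn (fractionSum.incl f hn n x) = fractionSum.incl f hn n x -
      fractionSum.incl f hn (n + 1)
        (Submodule.inclusion (fractionSubmodule_monotone f hn n.le_succ) x) := by
  simp [telescopeMap]

/-- The summation map `⨁ A s⁻ⁿ → B`. -/
noncomputable def fractionSum.sum : fractionSum f hn →ₗ[A ⊗[𝕂] Aᵐᵒᵖ] bimodule 𝕂 f :=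
  DirectSum.toModule _ ℕ _ fun n => (fractionSubmodule f hn n).subtype

lemma fractionSum.sum_incl (n : ℕ) (x : fractionSubmodule f hn n) :
    fractionSum.sum f hn (fractionSum.incl f hn n x) = x := by
  simp [fractionSum.sum]

lemma fractionSum.sum_telescopeMap (t : fractionSum f hn) :
    fractionSum.sum f hn (telescopeMap f hn t) = 0 := by
  induction t using DirectSum.induction_on with
  | zero => simp
  | of n x =>
    change fractionSum.sum f hn (telescopeMap f hn (fractionSum.incl f hn n x)) = 0
    rw [telescopeMap_incl, map_sub, fractionSum.sum_incl, fractionSum.sum_incl]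
    exact sub_self _
  | add x y hx hy => rw [map_add, map_add, hx, hy, add_zero]

lemma telescopeMap_apply_zero (t : fractionSum f hn) :
    ((telescopeMap f hn t 0 : fractionSubmodule f hn 0) : bimodule 𝕂 f) = t 0 := by
  induction t using DirectSum.induction_on with
  | zero => simp
  | of n x =>
    change ((telescopeMap f hn (fractionSum.incl f hn n x) 0 : fractionSubmodule f hn 0) :
      bimodule 𝕂 f) = _
    rw [telescopeMap_incl]
    change ((DirectSum.of _ n x - DirectSum.of (fun n => fractionSubmodule f hn n) (n + 1) _ :
      fractionSum f hn) 0 : bimodule 𝕂 f) = _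
    rw [DirectSum.sub_apply, DirectSum.of_eq_of_ne (n + 1) 0 _ (by simp), sub_zero]
  | add x y hx hy =>
    rw [map_add, DirectSum.add_apply, DirectSum.add_apply, Submodule.coe_add, Submodule.coe_add,
      hx, hy]

lemma telescopeMap_apply_succ (t : fractionSum f hn) (n : ℕ) :
    ((telescopeMap f hn t (n + 1) : fractionSubmodule f hn (n + 1)) : bimodule 𝕂 f) =
      t (n + 1) - t n := by
  induction t using DirectSum.induction_on with
  | zero => simp
  | of m x =>
    change ((telescopeMap f hn (fractionSum.incl f hn m x) (n + 1) :
      fractionSubmodule f hn (n + 1)) : bimodule 𝕂 f) = _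
    rw [telescopeMap_incl]
    change ((DirectSum.of _ m x - DirectSum.of (fun n => fractionSubmodule f hn n) (m + 1) _ :
      fractionSum f hn) (n + 1) : bimodule 𝕂 f) = _
    rw [DirectSum.sub_apply, Submodule.coe_sub]
    congr 1
    by_cases h : m = n
    · subst h
      rw [DirectSum.of_eq_same, DirectSum.of_eq_same]
      rfl
    · rw [DirectSum.of_eq_of_ne _ _ _ (Ne.symm h), DirectSum.of_eq_of_ne _ _ _ (by simpa using Ne.symm h)]
      rfl
  | add x y hx hy =>
    rw [map_add, DirectSum.add_apply, DirectSum.add_apply, DirectSum.add_apply, Submodule.coe_add,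
      Submodule.coe_add, Submodule.coe_add, hx, hy]
    abel

/-- The map is triangular: the coordinates of `t` are recovered one after the other from `t 0` and
the differences `t (n + 1) - t n`. -/
lemma telescopeMap_injective : Function.Injective (telescopeMap f hn) := by
  rw [injective_iff_map_eq_zero]
  intro t ht
  have h (n : ℕ) : (t n : bimodule 𝕂 f) = 0 := by
    induction n with
    | zero => rw [← telescopeMap_apply_zero, ht]; rfl
    | succ n ih =>
      have := telescopeMap_apply_succ f hn t n
      rw [ht, ih, sub_zero] at this
      exact this.symm
  ext n
  exact h n

/-- Modulo the image of the telescope map, an element of `A s⁻ⁿ` can be moved to any later summand.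
So `t` is congruent to an element of a single summand, and that element is the sum of `t` in `B`,
hence zero. -/
lemma exists_telescopeMap_eq_of_sum_eq_zero (t : fractionSum f hn)
    (ht : fractionSum.sum f hn t = 0) : ∃ t', telescopeMap f hn t' = t := by
  have key (n m : ℕ) (h : n ≤ m) (x : fractionSubmodule f hn n) : ∃ t',
      telescopeMap f hn t' = fractionSum.incl f hn n x -
        fractionSum.incl f hn m (Submodule.inclusion (fractionSubmodule_monotone f hn h) x) := by
    induction m, h using Nat.le_induction with
    | base => exact ⟨0, by rw [map_zero]; exact (sub_self _).symm⟩
    | succ m h ih =>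
      obtain ⟨t', ht'⟩ := ih
      refine ⟨t' + fractionSum.incl f hn m
        (Submodule.inclusion (fractionSubmodule_monotone f hn h) x), ?_⟩
      rw [map_add, ht', telescopeMap_incl, sub_add_sub_cancel]
      rfl
  -- All large `m` are allowed, so that representatives of two elements can be placed in the same
  -- summand and added.
  have key' : ∀ t : fractionSum f hn, ∃ N, ∀ m, N ≤ m → ∃ (y : fractionSubmodule f hn m)
      (t' : fractionSum f hn), (y : bimodule 𝕂 f) = fractionSum.sum f hn t ∧
        telescopeMap f hn t' = t - fractionSum.incl f hn m y := by
    intro t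
    induction t using DirectSum.induction_on with
    | zero => exact ⟨0, fun m _ => ⟨0, 0, by simp, by simp⟩⟩
    | of n x =>
      refine ⟨n, fun m h => ?_⟩
      obtain ⟨t', ht'⟩ := key n m h x
      exact ⟨_, t', (fractionSum.sum_incl f hn n x).symm, ht'⟩
    | add x y hx hy =>
      obtain ⟨N, hN⟩ := hx
      obtain ⟨N', hN'⟩ := hy
      refine ⟨max N N', fun m h => ?_⟩
      obtain ⟨z, t, hz, ht⟩ := hN m ((le_max_left _ _).trans h)
      obtain ⟨z', t', hz', ht'⟩ := hN' m ((le_max_right _ _).trans h)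
      refine ⟨z + z', t + t', by rw [Submodule.coe_add, hz, hz', map_add], ?_⟩
      rw [map_add, map_add, ht, ht']
      abel
  obtain ⟨N, hN⟩ := key' t
  obtain ⟨y, t', hy, ht'⟩ := hN N le_rfl
  rw [ht] at hy
  obtain rfl : y = 0 := Subtype.ext hy
  exact ⟨t', by rw [ht', map_zero, sub_zero]⟩

lemma fractionSum.sum_surjective (hB : ∀ x : B, ∃ (n : ℕ) (a : A), x * f s ^ n = f a) :
    Function.Surjective (fractionSum.sum f hn) := by
  intro x
  obtain ⟨n, a, h⟩ := hB (bimoduleAddEquiv f x)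
  exact ⟨fractionSum.incl f hn n ⟨x, a, h⟩, fractionSum.sum_incl f hn n _⟩

section Free

variable (hf : Function.Injective f)

/-- The element `a` such that a given element of `A s⁻ⁿ` is `a s⁻ⁿ`. -/
noncomputable def fractionSubmodule.num (n : ℕ) : fractionSubmodule f hn n →+ A where
  toFun x := x.2.choose
  map_zero' := hf (by rw [← (0 : fractionSubmodule f hn n).2.choose_spec]; simp)
  map_add' x y := hf (by
    rw [map_add, ← (x + y).2.choose_spec, ← x.2.choose_spec, ← y.2.choose_spec, ← add_mul,
      ← map_add]
    rfl)

lemma fractionSubmodule.map_num (n : ℕ) (x : fractionSubmodule f hn n) :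
    f (fractionSubmodule.num f hn hf n x) = bimoduleAddEquiv f x * f s ^ n :=
  x.2.choose_spec.symm

lemma fractionSubmodule.num_smul (n : ℕ) (a : A) (x : fractionSubmodule f hn n) :
    fractionSubmodule.num f hn hf n ((a ⊗ₜ[𝕂] (1 : Aᵐᵒᵖ)) • x) =
      a * fractionSubmodule.num f hn hf n x := by
  apply hf
  rw [map_mul, fractionSubmodule.map_num, fractionSubmodule.map_num, ← mul_assoc]
  congr 1
  have := bimoduleAddEquiv_smul f a 1 x
  rw [map_one, mul_one] at this
  exact this

/-- The element `s⁻ⁿ` of `A s⁻ⁿ`. -/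
noncomputable def fractionSubmodule.gen (hu : IsUnit (f s)) (n : ℕ) : fractionSubmodule f hn n :=
  ⟨(bimoduleAddEquiv f).symm ((hu.unit⁻¹ ^ n : Bˣ) : B), 1, by
    rw [AddEquiv.apply_symm_apply, map_one]
    change ((hu.unit⁻¹ ^ n : Bˣ) : B) * (hu.unit : B) ^ n = 1
    rw [← Units.val_pow_eq_pow_val, ← Units.val_mul, inv_pow, inv_mul_cancel, Units.val_one]⟩

lemma fractionSubmodule.num_gen (hu : IsUnit (f s)) (n : ℕ) :
    fractionSubmodule.num f hn hf n (fractionSubmodule.gen f hn hu n) = 1 := by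
  apply hf
  rw [fractionSubmodule.map_num, map_one]
  change ((hu.unit⁻¹ ^ n : Bˣ) : B) * (hu.unit : B) ^ n = 1
  rw [← Units.val_pow_eq_pow_val, ← Units.val_mul, inv_pow, inv_mul_cancel, Units.val_one]

lemma fractionSubmodule.num_smul_gen (hu : IsUnit (f s)) (n : ℕ) (x : fractionSubmodule f hn n) :
    (fractionSubmodule.num f hn hf n x ⊗ₜ[𝕂] (1 : Aᵐᵒᵖ)) • fractionSubmodule.gen f hn hu n = x := by
  apply Subtype.ext
  apply (bimoduleAddEquiv f).injective
  refine (bimoduleAddEquiv_smul f _ 1 _).trans ?_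
  rw [map_one, mul_one, fractionSubmodule.map_num, mul_assoc]
  change _ * ((hu.unit : B) ^ n * ((hu.unit⁻¹ ^ n : Bˣ) : B)) = _
  rw [← Units.val_pow_eq_pow_val, ← Units.val_mul, inv_pow, mul_inv_cancel, Units.val_one, mul_one]

/-- The direct sum `⨁ A s⁻ⁿ`, as a left module. -/
noncomputable abbrev leftFractionSum : ModuleCat.{u} A :=
  (ModuleCat.restrictScalars.{u} (toEnveloping 𝕂 A)).obj
    (ModuleCat.of (A ⊗[𝕂] Aᵐᵒᵖ) (fractionSum f hn))

/-- Right multiplication by `f s ^ n` identifies `A s⁻ⁿ` with `A` as a left module, thanks to the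
injectivity of `f`, and sends `s⁻ⁿ` to `1`. -/
lemma isFreeFamily_leftFractionSum (hf : Function.Injective f) (hu : IsUnit (f s)) :
    IsFreeFamily (leftFractionSum f hn)
      (fun n => fractionSum.incl f hn n (fractionSubmodule.gen f hn hu n)) := by
  intro M m
  let g : fractionSum f hn →+ M := DirectSum.toAddMonoid fun n =>
    (AddMonoidHom.flip (smulAddHom A M) (m n)).comp (fractionSubmodule.num f hn hf n)
  have hg (n : ℕ) (x) : g (fractionSum.incl f hn n x) = fractionSubmodule.num f hn hf n x • m n :=
    DirectSum.toAddMonoid_of _ _ _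
  refine ⟨ModuleCat.ofHom (X := leftFractionSum f hn) (Y := M)
    { toFun := g
      map_add' := map_add g
      map_smul' := fun a x => ?_ }, fun n => ?_, fun h hh => ?_⟩
  · change g ((a ⊗ₜ[𝕂] (1 : Aᵐᵒᵖ)) • (show fractionSum f hn from x)) = a • g x
    induction x using DirectSum.induction_on with
    | zero => simp
    | of n x =>
      change g ((a ⊗ₜ[𝕂] (1 : Aᵐᵒᵖ)) • fractionSum.incl f hn n x) =
        a • g (fractionSum.incl f hn n x)
      rw [← map_smul, hg, hg, fractionSubmodule.num_smul, mul_smul]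
    | add x y hx hy =>
      refine (congrArg g (smul_add _ _ _)).trans ?_
      rw [map_add, hx, hy, map_add, smul_add]
  · exact (hg n _).trans (by rw [fractionSubmodule.num_gen, one_smul])
  · refine ModuleCat.hom_ext (LinearMap.ext fun x => ?_)
    change h.hom x = g x
    induction x using DirectSum.induction_on with
    | zero => exact (map_zero h.hom).trans (map_zero g).symm
    | of n x =>
      change h.hom (fractionSum.incl f hn n x) = g (fractionSum.incl f hn n x)
      rw [hg, ← hh n]
      refine Eq.trans (congrArg h.hom ?_) (map_smul h.hom (fractionSubmodule.num f hn hf n x) _)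
      have := congrArg (fractionSum.incl f hn n) (fractionSubmodule.num_smul_gen f hn hf hu n x)
      rw [map_smul] at this
      exact this.symm
    | add x y hx hy => exact (map_add h.hom x y).trans ((congrArg₂ _ hx hy).trans (map_add g x y).symm)

end Free

end Bimodule

/-! ### The telescope complex, its left bases and its central elements. -/

section Telescope

open MulOpposite

variable {𝕂 : Type t} [CommRing 𝕂] {A : Type u} [Ring A] [Algebra 𝕂 A]
  {B : Type u} [Ring B] [Algebra 𝕂 B] (f : A →ₐ[𝕂] B) {s : A} (hn : IsNormalElement s)

/-- The map of bimodules `A → A s⁰`. -/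
noncomputable def toFractionSubmoduleZero :
    bimodule 𝕂 (AlgHom.id 𝕂 A) →ₗ[A ⊗[𝕂] Aᵐᵒᵖ] fractionSubmodule f hn 0 :=
  (bimoduleMap 𝕂 f).hom.codRestrict _ fun x =>
    ⟨bimoduleAddEquiv (AlgHom.id 𝕂 A) x, by rw [pow_zero, mul_one, bimoduleAddEquiv_bimoduleMap]⟩

/-- The differential of the telescope complex. -/
noncomputable def telescopeDifferential :
    ModuleCat.of (A ⊗[𝕂] Aᵐᵒᵖ) (bimodule 𝕂 (AlgHom.id 𝕂 A) × fractionSum f hn) ⟶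
      ModuleCat.of (A ⊗[𝕂] Aᵐᵒᵖ) (fractionSum f hn) :=
  ModuleCat.ofHom
    ((fractionSum.incl f hn 0 ∘ₗ toFractionSubmoduleZero f hn).coprod (telescopeMap f hn))

/-- The telescope complex: a complex of bimodules which is free as a complex of left modules, and
resolves the complex `A → B` when `B` is the union of the `A s⁻ⁿ`. -/
noncomputable def telescope : CochainComplex (ModuleCat.{u} (A ⊗[𝕂] Aᵐᵒᵖ)) ℤ :=
  HomologicalComplex.double (telescopeDifferential f hn)
    (show (ComplexShape.up ℤ).Rel 0 1 by simp)

/-- The projection of the telescope complex to the complex `A → B`. -/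
noncomputable def telescopeProj : telescope f hn ⟶
    HomologicalComplex.double (bimoduleMap 𝕂 f) (show (ComplexShape.up ℤ).Rel 0 1 by simp) :=
  HomologicalComplex.mkHomFromDouble _ zero_ne_one
    (ModuleCat.ofHom (LinearMap.fst _ _ _) ≫ (HomologicalComplex.doubleXIso₀ _ _).inv)
    (ModuleCat.ofHom (fractionSum.sum f hn) ≫
      (HomologicalComplex.doubleXIso₁ _ _ zero_ne_one).inv)
    (by
      rw [HomologicalComplex.double_d _ _ zero_ne_one]
      simp only [Category.assoc, Iso.inv_hom_id_assoc]
      rw [← Category.assoc, ← Category.assoc]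
      congr 1
      refine ModuleCat.hom_ext (LinearMap.ext fun x => ?_)
      change (bimoduleMap 𝕂 f).hom x.1 = fractionSum.sum f hn
        (fractionSum.incl f hn 0 (toFractionSubmoduleZero f hn x.1) + telescopeMap f hn x.2)
      rw [map_add, fractionSum.sum_incl, fractionSum.sum_telescopeMap, add_zero]
      rfl)
    (fun k _ => by rw [HomologicalComplex.double_d_eq_zero₀ _ _ 1 k one_ne_zero, Limits.comp_zero])

/-- The complex of left modules underlying the telescope complex. -/
noncomputable abbrev leftTelescope : CochainComplex (ModuleCat.{u} A) ℤ :=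
  leftComplex (telescope f hn)

lemma isZero_leftTelescope_X (n : ℤ) (h₀ : n ≠ 0) (h₁ : n ≠ 1) :
    Limits.IsZero ((leftTelescope f hn).X n) :=
  (ModuleCat.restrictScalars.{u} (toEnveloping 𝕂 A)).map_isZero
    (HomologicalComplex.isZero_double_X _ _ n h₀ h₁)

/-- The source of the differential of the telescope complex, as a left module. -/
noncomputable abbrev leftTelescopeSource : ModuleCat.{u} A :=
  (ModuleCat.restrictScalars.{u} (toEnveloping 𝕂 A)).obj
    (ModuleCat.of (A ⊗[𝕂] Aᵐᵒᵖ) (bimodule 𝕂 (AlgHom.id 𝕂 A) × fractionSum f hn))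

/-- The module in degree `0` of the telescope complex. -/
noncomputable def leftTelescopeX₀ : leftTelescopeSource f hn ≅ (leftTelescope f hn).X 0 :=
  (ModuleCat.restrictScalars.{u} (toEnveloping 𝕂 A)).mapIso
    (HomologicalComplex.doubleXIso₀ (telescopeDifferential f hn) _).symm

/-- The module in degree `1` of the telescope complex. -/
noncomputable def leftTelescopeX₁ : leftFractionSum f hn ≅ (leftTelescope f hn).X 1 :=
  (ModuleCat.restrictScalars.{u} (toEnveloping 𝕂 A)).mapIso
    (HomologicalComplex.doubleXIso₁ (telescopeDifferential f hn) _ zero_ne_one).symm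

lemma leftTelescopeX₀_hom_d : (leftTelescopeX₀ f hn).hom ≫ (leftTelescope f hn).d 0 1 =
    (ModuleCat.restrictScalars.{u} (toEnveloping 𝕂 A)).map (telescopeDifferential f hn) ≫
      (leftTelescopeX₁ f hn).hom := by
  change (ModuleCat.restrictScalars.{u} (toEnveloping 𝕂 A)).map _ ≫
    (ModuleCat.restrictScalars.{u} (toEnveloping 𝕂 A)).map ((telescope f hn).d 0 1) =
      _ ≫ (ModuleCat.restrictScalars.{u} (toEnveloping 𝕂 A)).map _
  rw [← Functor.map_comp, ← Functor.map_comp]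
  congr 1
  have h := HomologicalComplex.double_d (telescopeDifferential f hn)
    (show (ComplexShape.up ℤ).Rel 0 1 by simp) zero_ne_one
  refine (congrArg _ h).trans ?_
  exact Iso.inv_hom_id_assoc _ _

/-- The unit of the ring, as an element of `A s⁻ⁿ`. -/
noncomputable def fractionSubmodule.one (n : ℕ) : fractionSubmodule f hn n :=
  ⟨(bimoduleAddEquiv f).symm 1, s ^ n, by simp⟩

lemma fractionSubmodule.one_smul_comm (n : ℕ) (a : A) :
    ((1 : A) ⊗ₜ[𝕂] op a) • fractionSubmodule.one f hn n =
      (a ⊗ₜ[𝕂] (1 : Aᵐᵒᵖ)) • fractionSubmodule.one f hn n := by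
  apply Subtype.ext
  apply (bimoduleAddEquiv f).injective
  refine (bimoduleAddEquiv_smul f 1 a _).trans
    (Eq.trans ?_ (bimoduleAddEquiv_smul f a 1 _).symm)
  simp [fractionSubmodule.one]

lemma fractionSubmodule.smul_gen (hu : IsUnit (f s)) (n : ℕ) :
    ((s ^ n : A) ⊗ₜ[𝕂] (1 : Aᵐᵒᵖ)) • fractionSubmodule.gen f hn hu n = fractionSubmodule.one f hn n := by
  apply Subtype.ext
  apply (bimoduleAddEquiv f).injective
  refine (bimoduleAddEquiv_smul f (s ^ n) 1 _).trans ?_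
  change f (s ^ n) * ((hu.unit⁻¹ ^ n : Bˣ) : B) * f 1 = 1
  rw [map_one, mul_one, map_pow]
  change (hu.unit : B) ^ n * ((hu.unit⁻¹ ^ n : Bˣ) : B) = 1
  rw [← Units.val_pow_eq_pow_val, ← Units.val_mul, inv_pow, mul_inv_cancel, Units.val_one]

/-- The generators of the source of the telescope complex. -/
noncomputable def leftTelescopeGen (hu : IsUnit (f s)) : Option ℕ → leftTelescopeSource f hn
  | none => ((bimoduleAddEquiv (AlgHom.id 𝕂 A)).symm 1, 0)
  | some n => (0, fractionSum.incl f hn n (fractionSubmodule.gen f hn hu n))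

lemma isFreeFamily_leftTelescopeGen (hf : Function.Injective f) (hu : IsUnit (f s)) :
    IsFreeFamily (leftTelescopeSource f hn) (leftTelescopeGen f hn hu) := by
  intro M m
  obtain ⟨g, hg⟩ := (isFreeFamily_leftFractionSum f hn hf hu).exists_hom (fun n => m (some n))
  have smul_fst (a : A) (x : bimodule 𝕂 (AlgHom.id 𝕂 A)) :
      bimoduleAddEquiv (AlgHom.id 𝕂 A) ((a ⊗ₜ[𝕂] (1 : Aᵐᵒᵖ)) • x) =
        a * bimoduleAddEquiv (AlgHom.id 𝕂 A) x :=
    (bimoduleAddEquiv_smul _ a 1 x).trans (by simp)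
  refine ⟨ModuleCat.ofHom (X := leftTelescopeSource f hn) (Y := M)
    { toFun := fun x => bimoduleAddEquiv (AlgHom.id 𝕂 A) x.1 • m none + g.hom x.2
      map_add' := fun x y => ?_
      map_smul' := fun a x => ?_ }, fun n => ?_, fun h hh => ?_⟩
  · refine (congrArg₂ (· + ·) ((congrArg (· • m none) (map_add _ x.1 y.1)).trans
      (add_smul _ _ _)) (map_add g.hom x.2 y.2)).trans ?_
    exact add_add_add_comm _ _ _ _
  · rw [smul_add]
    exact congrArg₂ (· + ·) ((congrArg (· • m none) (smul_fst a x.1)).trans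
      (mul_smul _ _ _)) (map_smul g.hom a (show leftFractionSum f hn from x.2))
  · cases n with
    | none =>
      change bimoduleAddEquiv (AlgHom.id 𝕂 A) ((bimoduleAddEquiv (AlgHom.id 𝕂 A)).symm 1) •
        m none + g.hom 0 = m none
      rw [AddEquiv.apply_symm_apply, one_smul, map_zero, add_zero]
    | some n =>
      change bimoduleAddEquiv (AlgHom.id 𝕂 A) 0 • m none + _ = m (some n)
      rw [map_zero, zero_smul, zero_add]
      exact hg n
  · refine ModuleCat.hom_ext (LinearMap.ext fun x => ?_)
    change h.hom x = bimoduleAddEquiv (AlgHom.id 𝕂 A) x.1 • m none + g.hom x.2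
    have hT : ModuleCat.ofHom (X := leftFractionSum f hn) (Y := leftTelescopeSource f hn)
        { toFun := fun t => (0, t)
          map_add' := fun t t' => Prod.ext (add_zero _).symm rfl
          map_smul' := fun a t => Prod.ext (smul_zero (a ⊗ₜ[𝕂] (1 : Aᵐᵒᵖ))).symm rfl } ≫ h = g :=
      (isFreeFamily_leftFractionSum f hn hf hu).hom_ext fun n => (hh (some n)).trans (hg n).symm
    have h₂ : g.hom x.2 = h.hom ((0, x.2) : bimodule 𝕂 (AlgHom.id 𝕂 A) × fractionSum f hn) := by
      rw [← hT]
      rfl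
    have h₁ : bimoduleAddEquiv (AlgHom.id 𝕂 A) x.1 • m none =
        h.hom ((x.1, 0) : bimodule 𝕂 (AlgHom.id 𝕂 A) × fractionSum f hn) := by
      rw [← hh none]
      refine (map_smul h.hom _ _).symm.trans (congrArg h.hom ?_)
      refine Prod.ext ?_ (smul_zero _)
      apply (bimoduleAddEquiv (AlgHom.id 𝕂 A)).injective
      refine (smul_fst _ _).trans ?_
      change _ * bimoduleAddEquiv (AlgHom.id 𝕂 A) ((bimoduleAddEquiv (AlgHom.id 𝕂 A)).symm 1) = _
      rw [AddEquiv.apply_symm_apply, mul_one]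
    rw [h₁, h₂]
    refine Eq.trans (congrArg h.hom ?_) (map_add h.hom _ _)
    exact Prod.ext (add_zero _).symm (zero_add _).symm

/-- The sum of the units of the summands `A s⁻ʲ` for `j < k`. -/
noncomputable def fractionSum.partialUnit (k : ℕ) : fractionSum f hn :=
  ∑ j ∈ Finset.range k, fractionSum.incl f hn j (fractionSubmodule.one f hn j)

lemma telescopeMap_partialUnit (k : ℕ) : telescopeMap f hn (fractionSum.partialUnit f hn k) =
    fractionSum.incl f hn 0 (fractionSubmodule.one f hn 0) -
      fractionSum.incl f hn k (fractionSubmodule.one f hn k) := by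
  induction k with
  | zero => simp [fractionSum.partialUnit]
  | succ k ih =>
    rw [fractionSum.partialUnit, Finset.sum_range_succ, map_add, telescopeMap_incl]
    rw [fractionSum.partialUnit] at ih
    rw [ih, sub_add_sub_cancel]
    rfl

/-- Elements `b k` of the source of the telescope complex which commute with `A` and which the
differential maps to multiples of `s ^ k`. -/
noncomputable def leftTelescopeCentral (k : ℕ) : leftTelescopeSource f hn :=
  ((bimoduleAddEquiv (AlgHom.id 𝕂 A)).symm 1, -fractionSum.partialUnit f hn k)

lemma leftTelescopeCentral_zero (hu : IsUnit (f s)) :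
    leftTelescopeCentral f hn 0 = leftTelescopeGen f hn hu none := by
  refine Prod.ext rfl ?_
  change -(∑ j ∈ Finset.range 0, _) = (0 : fractionSum f hn)
  simp

lemma leftTelescopeCentral_sub (hu : IsUnit (f s)) (k : ℕ) :
    leftTelescopeCentral f hn k - leftTelescopeCentral f hn (k + 1) =
      s ^ k • leftTelescopeGen f hn hu (some k) := by
  refine Prod.ext ((sub_self _).trans (smul_zero ((s ^ k : A) ⊗ₜ[𝕂] (1 : Aᵐᵒᵖ))).symm) ?_
  change -(∑ j ∈ Finset.range k, _) - -(∑ j ∈ Finset.range (k + 1), _) =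
    ((s ^ k : A) ⊗ₜ[𝕂] (1 : Aᵐᵒᵖ)) • fractionSum.incl f hn k (fractionSubmodule.gen f hn hu k)
  rw [← map_smul, fractionSubmodule.smul_gen, Finset.sum_range_succ]
  abel

/-- The differential sends `1` in `A` to the unit of `A s⁰`. The partial sum of units telescopes and
moves this to the unit of `A s⁻ᵏ`, which is `s ^ k` times the generator. -/
lemma telescopeDifferential_leftTelescopeCentral (hu : IsUnit (f s)) (k : ℕ) :
    ((ModuleCat.restrictScalars.{u} (toEnveloping 𝕂 A)).map (telescopeDifferential f hn)).hom
      (leftTelescopeCentral f hn k) = s ^ k • (show leftFractionSum f hn from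
        fractionSum.incl f hn k (fractionSubmodule.gen f hn hu k)) := by
  change fractionSum.incl f hn 0 (toFractionSubmoduleZero f hn
    ((bimoduleAddEquiv (AlgHom.id 𝕂 A)).symm 1)) +
      telescopeMap f hn (-fractionSum.partialUnit f hn k) =
      ((s ^ k : A) ⊗ₜ[𝕂] (1 : Aᵐᵒᵖ)) • fractionSum.incl f hn k (fractionSubmodule.gen f hn hu k)
  rw [← map_smul, fractionSubmodule.smul_gen, map_neg, telescopeMap_partialUnit]
  have : toFractionSubmoduleZero f hn ((bimoduleAddEquiv (AlgHom.id 𝕂 A)).symm 1) =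
      fractionSubmodule.one f hn 0 := Subtype.ext (map_one f)
  rw [this]
  abel

/-- All nonzero components are `±1`, on which the left and right actions of `A` agree. The basis
elements `s⁻ⁿ` need not commute with `A`, so evaluation at them would not be linear. -/
lemma leftTelescopeCentral_comm (a : A) (k : ℕ) :
    ((1 : A) ⊗ₜ[𝕂] op a) • (show bimodule 𝕂 (AlgHom.id 𝕂 A) × fractionSum f hn from
      leftTelescopeCentral f hn k) = (a ⊗ₜ[𝕂] (1 : Aᵐᵒᵖ)) •
        (show bimodule 𝕂 (AlgHom.id 𝕂 A) × fractionSum f hn from leftTelescopeCentral f hn k) := by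
  refine Prod.ext ?_ ?_
  · apply (bimoduleAddEquiv (AlgHom.id 𝕂 A)).injective
    refine (bimoduleAddEquiv_smul _ 1 a _).trans
      (Eq.trans ?_ (bimoduleAddEquiv_smul _ a 1 _).symm)
    simp [leftTelescopeCentral]
  · change ((1 : A) ⊗ₜ[𝕂] op a) • (-fractionSum.partialUnit f hn k) =
      (a ⊗ₜ[𝕂] (1 : Aᵐᵒᵖ)) • (-fractionSum.partialUnit f hn k)
    rw [smul_neg, smul_neg, fractionSum.partialUnit, Finset.smul_sum, Finset.smul_sum]
    refine congrArg Neg.neg (Finset.sum_congr rfl fun j _ => ?_)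
    rw [← map_smul, ← map_smul, fractionSubmodule.one_smul_comm]

end Telescope

/-! ### The properties of the telescope that the comparison uses. -/

section TelescopeBasis

open MulOpposite

variable {𝕂 : Type t} [CommRing 𝕂] {A : Type u} [Ring A] [Algebra 𝕂 A]

/-- A complex of bimodules `E` in degrees `0` and `1`, free as a complex of left modules, with
elements `central k` of degree `0` which commute with `A` and which are mapped by the differential
to multiples of `s ^ k`. -/
structure TelescopeBasis (E : CochainComplex (ModuleCat.{u} (A ⊗[𝕂] Aᵐᵒᵖ)) ℤ) (s : A) where
  /-- the basis in degree `0` -/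
  gen₀ : Option ℕ → (leftComplex E).X 0
  /-- the basis in degree `1` -/
  gen₁ : ℕ → (leftComplex E).X 1
  /-- the central elements -/
  central : ℕ → (leftComplex E).X 0
  isZero : ∀ n : ℤ, n ≠ 0 → n ≠ 1 → Limits.IsZero ((leftComplex E).X n)
  free₀ : IsFreeFamily _ gen₀
  free₁ : IsFreeFamily _ gen₁
  central_zero : central 0 = gen₀ none
  central_sub : ∀ k, central k - central (k + 1) = s ^ k • gen₀ (some k)
  d_central : ∀ k, ((leftComplex E).d 0 1).hom (central k) = s ^ k • gen₁ k
  rightMul_central : ∀ (a : A) k, ((rightMul E a).f 0).hom (central k) = a • central k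

/-- The basis of the telescope complex. -/
noncomputable def telescopeBasis {B : Type u} [Ring B] [Algebra 𝕂 B] (f : A →ₐ[𝕂] B) {s : A}
    (hn : IsNormalElement s) (hf : Function.Injective f) (hu : IsUnit (f s)) :
    TelescopeBasis (telescope f hn) s where
  gen₀ i := (leftTelescopeX₀ f hn).hom.hom (leftTelescopeGen f hn hu i)
  gen₁ n := (leftTelescopeX₁ f hn).hom.hom
    (fractionSum.incl f hn n (fractionSubmodule.gen f hn hu n))
  central k := (leftTelescopeX₀ f hn).hom.hom (leftTelescopeCentral f hn k)
  isZero := isZero_leftTelescope_X f hn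
  free₀ := (isFreeFamily_leftTelescopeGen f hn hf hu).of_iso (leftTelescopeX₀ f hn)
  free₁ := (isFreeFamily_leftFractionSum f hn hf hu).of_iso (leftTelescopeX₁ f hn)
  central_zero := by rw [leftTelescopeCentral_zero f hn hu]
  central_sub k := by
    rw [← map_sub, leftTelescopeCentral_sub f hn hu, map_smul]
  d_central k := by
    have h := congrArg (fun g => g.hom (leftTelescopeCentral f hn k)) (leftTelescopeX₀_hom_d f hn)
    refine h.trans ?_
    refine (congrArg (leftTelescopeX₁ f hn).hom.hom
      (telescopeDifferential_leftTelescopeCentral f hn hu k)).trans ?_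
    exact map_smul (leftTelescopeX₁ f hn).hom.hom _ _
  rightMul_central a k := by
    let e := (HomologicalComplex.doubleXIso₀ (telescopeDifferential f hn)
      (show (ComplexShape.up ℤ).Rel 0 1 by simp)).inv.hom
    refine (map_smul e ((1 : A) ⊗ₜ[𝕂] op a) (leftTelescopeCentral f hn k)).symm.trans
      ((congrArg e (leftTelescopeCentral_comm f hn a k)).trans ?_)
    exact map_smul e (a ⊗ₜ[𝕂] (1 : Aᵐᵒᵖ)) (leftTelescopeCentral f hn k)

namespace TelescopeBasis

variable {E : CochainComplex (ModuleCat.{u} (A ⊗[𝕂] Aᵐᵒᵖ)) ℤ} {s : A} (b : TelescopeBasis E s)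

include b

lemma projective (n : ℤ) : Projective ((leftComplex E).X n) := by
  by_cases h₀ : n = 0
  · subst h₀
    exact b.free₀.projective
  · by_cases h₁ : n = 1
    · subst h₁
      exact b.free₁.projective
    · exact (b.isZero n h₀ h₁).projective

lemma isKProjective : (leftComplex E).IsKProjective := by
  have := b.projective
  have : (leftComplex E).IsStrictlyLE 1 := by
    rw [CochainComplex.isStrictlyLE_iff]
    intro i hi
    exact b.isZero i (by omega) (by omega)
  exact CochainComplex.isKProjective_of_projective _ 1

lemma quasiIso_homComplexMap {M N : CochainComplex (ModuleCat.{u} A) ℤ} (f : M ⟶ N)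
    [QuasiIso f] : QuasiIso ((homComplexFunctor E).map f) := by
  have := b.isKProjective
  refine CochainComplex.quasiIso_of_forall_exists _ fun n x y hx hxy => ?_
  exact CochainComplex.IsKProjective.exists_of_quasiIso (leftComplex E) f n (n - 1) (by omega)
    x y hx hxy

end TelescopeBasis

end TelescopeBasis

/-! ### Natural transformations on quotient categories and their shifts. -/

namespace CategoryTheory.Quotient

variable {C D : Type*} [Category C] [Category D] {r : HomRel C} {G : Type*} [AddMonoid G]
  [HasShift C G] [HasShift D G] [r.IsCompatibleWithShift G] {F F' : C ⥤ D}
  [F.CommShift G] [F'.CommShift G]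
  (hF : ∀ (x y : C) (f₁ f₂ : x ⟶ y), r f₁ f₂ → F.map f₁ = F.map f₂)
  (hF' : ∀ (x y : C) (f₁ f₂ : x ⟶ y), r f₁ f₂ → F'.map f₁ = F'.map f₂)

/-- The natural transformation between the functors induced on a quotient category. -/
def liftNatTrans (τ : F ⟶ F') : Quotient.lift r F hF ⟶ Quotient.lift r F' hF' :=
  Quotient.natTransLift r ((Quotient.lift.isLift r F hF).hom ≫ τ ≫
    (Quotient.lift.isLift r F' hF').inv)

lemma liftNatTrans_app (τ : F ⟶ F') (X : C) :
    (liftNatTrans hF hF' τ).app ((Quotient.functor r).obj X) = τ.app X := by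
  dsimp [liftNatTrans]
  exact (Category.id_comp _).trans (Category.comp_id _)

instance liftNatTrans_commShift (τ : F ⟶ F') [NatTrans.CommShift τ G] :
    NatTrans.CommShift (liftNatTrans hF hF' τ) G where
  shift_comm a := by
    apply Quotient.natTrans_ext
    ext X
    have h := NatTrans.congr_app (NatTrans.shift_comm τ a) X
    have n := (liftNatTrans hF hF' τ).naturality (((Quotient.functor r).commShiftIso a).inv.app X)
    have e : (liftNatTrans hF hF' τ).app ((Quotient.functor r).obj (X⟦a⟧)) = τ.app (X⟦a⟧) :=
      liftNatTrans_app hF hF' τ (X⟦a⟧)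
    change ((Quotient.lift r F hF).commShiftIso a).hom.app ((Quotient.functor r).obj X) ≫
      ((liftNatTrans hF hF' τ).app ((Quotient.functor r).obj X))⟦a⟧' =
      (liftNatTrans hF hF' τ).app (((Quotient.functor r).obj X)⟦a⟧) ≫
        ((Quotient.lift r F' hF').commShiftIso a).hom.app ((Quotient.functor r).obj X)
    rw [liftNatTrans_app]
    change (LiftCommShift.iso F r hF a).hom.app ((Quotient.functor r).obj X) ≫ _ =
      _ ≫ (LiftCommShift.iso F' r hF' a).hom.app ((Quotient.functor r).obj X)
    rw [LiftCommShift.iso_hom_app, LiftCommShift.iso_hom_app, Category.assoc]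
    refine (congrArg (_ ≫ ·) h).trans ?_
    refine Eq.trans ?_ (Category.assoc _ _ _)
    refine Eq.trans ?_ (congrArg (· ≫ (F'.commShiftIso a).hom.app X) n)
    refine Eq.trans ?_ (Category.assoc _ _ _).symm
    exact congrArg (_ ≫ ·) (congrArg (· ≫ _) e.symm)

end CategoryTheory.Quotient

/-! ### Functoriality of `Hom(E, -)` in the complex of bimodules `E`. -/

section Precomp

open CochainComplex HomComplex MulOpposite

variable {𝕂 : Type t} [CommRing 𝕂] {A : Type u} [Ring A] [Algebra 𝕂 A]
  {E E' : CochainComplex (ModuleCat.{u} (A ⊗[𝕂] Aᵐᵒᵖ)) ℤ} (π : E ⟶ E')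

/-- The map of complexes of left modules underlying a map of complexes of bimodules. -/
noncomputable def leftComplexMap : leftComplex E ⟶ leftComplex E' :=
  ((ModuleCat.restrictScalars.{u} (toEnveloping 𝕂 A)).mapHomologicalComplex
      (ComplexShape.up ℤ)).map π

lemma rightMul_leftComplexMap (a : A) :
    rightMul E a ≫ leftComplexMap π = leftComplexMap π ≫ rightMul E' a := by
  ext i x
  exact map_smul (π.f i).hom ((1 : A) ⊗ₜ[𝕂] op a) (show E.X i from x)

/-- The natural transformation `Hom(E', -) ⟶ Hom(E, -)` given by the precomposition with a map
of complexes of bimodules `E ⟶ E'`. -/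
noncomputable def homComplexPrecomp : homComplexFunctor E' ⟶ homComplexFunctor E where
  app M :=
    { f := fun n => ModuleCat.ofHom
        (X := Cochain (leftComplex E') M n) (Y := Cochain (leftComplex E) M n)
        { toFun := fun z => (Cochain.ofHom (leftComplexMap π)).comp z (zero_add n)
          map_add' := fun z z' => Cochain.comp_add _ _ _ _
          map_smul' := fun a z => by
            simp only [homCochain_smul_def, RingHom.id_apply]
            rw [← Cochain.comp_assoc_of_first_is_zero_cochain,
              ← Cochain.comp_assoc_of_first_is_zero_cochain,
              ← Cochain.ofHom_comp, ← Cochain.ofHom_comp, rightMul_leftComplexMap] }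
      comm' := fun i j _ => by
        refine ModuleCat.hom_ext (LinearMap.ext fun z => ?_)
        exact δ_ofHom_comp (leftComplexMap π) (show Cochain (leftComplex E') M i from z) j }
  naturality M N f := by
    ext n z
    exact (Cochain.comp_assoc_of_first_is_zero_cochain
      (Cochain.ofHom (leftComplexMap π)) (show Cochain (leftComplex E') M n from z)
      (Cochain.ofHom f) (add_zero n)).symm

instance homComplexPrecomp_commShift : NatTrans.CommShift (homComplexPrecomp π) ℤ where
  shift_comm a := by
    refine NatTrans.ext (funext fun M => ?_)
    ext n : 1
    refine ModuleCat.hom_ext (LinearMap.ext ?_)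
    intro (z : Cochain (leftComplex E') (M⟦a⟧) n)
    change (Cochain.ofHom (leftComplexMap π)).comp (z.rightUnshift (n + a) rfl) (zero_add _) =
      Cochain.rightUnshift ((Cochain.ofHom (leftComplexMap π)).comp z (zero_add n)) (n + a) rfl
    ext1 p q hpq
    rw [Cochain.zero_cochain_comp_v, Cochain.rightUnshift_v _ _ _ p q hpq (p + n) rfl,
      Cochain.rightUnshift_v _ _ _ p q hpq (p + n) rfl, Cochain.zero_cochain_comp_v,
      Category.assoc]

/-- The natural transformation `Hom(E', -) ⟶ Hom(E, -)` between functors on the homotopy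
category. -/
noncomputable def homHomotopyPrecomp : homHomotopyFunctor E' ⟶ homHomotopyFunctor E :=
  Quotient.liftNatTrans _ _ (Functor.whiskerRight (homComplexPrecomp π)
    (HomotopyCategory.quotient (ModuleCat.{u} A) (ComplexShape.up ℤ)))

lemma homHomotopyPrecomp_app (M : CochainComplex (ModuleCat.{u} A) ℤ) :
    (homHomotopyPrecomp π).app ((HomotopyCategory.quotient _ _).obj M) =
      (HomotopyCategory.quotient _ _).map ((homComplexPrecomp π).app M) :=
  Quotient.liftNatTrans_app _ _ _ _

instance : NatTrans.CommShift (homHomotopyPrecomp π) ℤ :=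
  Quotient.liftNatTrans_commShift _ _ _

end Precomp

/-! ### When `Hom(E', -) ⟶ Hom(E, -)` is a quasi-isomorphism. -/

section

open CochainComplex HomComplex

variable {𝕂 : Type t} [CommRing 𝕂] {A : Type u} [Ring A] [Algebra 𝕂 A]

/-- A presentation of the kernel of an epimorphism between complexes in degrees `0` and `1`, in
terms of a map to the module in degree `0`. -/
structure TwoTermKernel {X X' : CochainComplex (ModuleCat.{u} A) ℤ} (φ : X ⟶ X')
    {T : ModuleCat.{u} A} (ι : T ⟶ X.X 0) : Prop where
  isZero : ∀ n : ℤ, n ≠ 0 → n ≠ 1 → Limits.IsZero (X.X n)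
  epi : ∀ n, Epi (φ.f n)
  comp_eq_zero : ι ≫ φ.f 0 = 0
  desc₀ : ∀ {M : ModuleCat.{u} A} (g : X.X 0 ⟶ M), ι ≫ g = 0 → ∃ g', φ.f 0 ≫ g' = g
  desc₁ : ∀ {M : ModuleCat.{u} A} (g : X.X 1 ⟶ M), (ι ≫ X.d 0 1) ≫ g = 0 →
    ∃ g', φ.f 1 ≫ g' = g

/-- Modules into which all maps extend along a given map. -/
def extensionProperty {T U : ModuleCat.{u} A} (j : T ⟶ U) : ObjectProperty (ModuleCat.{u} A) :=
  fun M => ∀ g : T ⟶ M, ∃ h : U ⟶ M, j ≫ h = g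

lemma CochainComplex.HomComplex.Cochain.exists_ofHom_comp_eq
    {X X' M : CochainComplex (ModuleCat.{u} A) ℤ} (φ : X ⟶ X') {n : ℤ} (y : Cochain X M n)
    (h : ∀ p q (hpq : p + n = q), ∃ g, φ.f p ≫ g = y.v p q hpq) :
    ∃ x : Cochain X' M n, (Cochain.ofHom φ).comp x (zero_add n) = y := by
  choose g hg using h
  refine ⟨Cochain.mk g, ?_⟩
  ext p q hpq : 1
  rw [Cochain.zero_cochain_comp_v, Cochain.ofHom_v, Cochain.mk_v, hg]

/-- The cochain is supported on `X.X 1`, with the sign that cancels the one in `δ`. It serves to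
change the component at `0` of a cochain, up to a coboundary, by a map factoring through `X.d 0 1`.
-/
lemma CochainComplex.HomComplex.Cochain.exists_δ_v_eq {X M : CochainComplex (ModuleCat.{u} A) ℤ}
    (m n : ℤ) (hmn : m + 1 = n) (h : X.X 1 ⟶ M.X n) :
    ∃ y : Cochain X M m, y.v 0 m (zero_add m) = 0 ∧
      (δ m n y).v 0 n (zero_add n) = X.d 0 1 ≫ h := by
  refine ⟨n.negOnePow • Cochain.single h m, ?_, ?_⟩
  · rw [Cochain.units_smul_v, Cochain.single_v_eq_zero _ _ 0 _ _ (by omega), smul_zero]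
  · rw [δ_v m n hmn _ 0 n (zero_add n) m 1 (by omega) rfl, Cochain.units_smul_v,
      Cochain.units_smul_v, Cochain.single_v, Cochain.single_v_eq_zero _ _ 0 _ _ (by omega),
      smul_zero, Limits.zero_comp, zero_add, Linear.comp_units_smul, smul_smul,
      Int.units_mul_self, one_smul]

/-- It suffices to correct a cochain on `E`, whose coboundary comes from `E'`, by a coboundary so
that it descends to `E'`. On the kernel in degree 0 the obstruction is a map from `T`; the extension
property writes it as the restriction of a coboundary. -/
lemma TwoTermKernel.quasiIso_homComplexPrecomp
    {E E' : CochainComplex (ModuleCat.{u} (A ⊗[𝕂] Aᵐᵒᵖ)) ℤ} {π : E ⟶ E'} {T : ModuleCat.{u} A}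
    {ι : T ⟶ (leftComplex E).X 0} (hι : TwoTermKernel (leftComplexMap π) ι)
    (M : CochainComplex (ModuleCat.{u} A) ℤ)
    (hM : ∀ n, extensionProperty (ι ≫ (leftComplex E).d 0 1) (M.X n)) :
    QuasiIso ((homComplexPrecomp π).app M) := by
  let φ := leftComplexMap π
  have hφ (n) : Epi (φ.f n) := hι.epi n
  have hinj {n : ℤ} {x x' : Cochain (leftComplex E') M n}
      (h : (Cochain.ofHom φ).comp x (zero_add n) = (Cochain.ofHom φ).comp x' (zero_add n)) :
      x = x' := by
    ext p q hpq : 1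
    have := Cochain.congr_v h p q hpq
    rw [Cochain.zero_cochain_comp_v, Cochain.zero_cochain_comp_v, Cochain.ofHom_v,
      cancel_epi] at this
    exact this
  refine CochainComplex.quasiIso_of_forall_exists _ fun n x y hx hxy => ?_
  replace hxy : (Cochain.ofHom φ).comp (show Cochain (leftComplex E') M (n + 1) from x)
    (zero_add _) = δ n (n + 1) (show Cochain (leftComplex E) M n from y) := hxy
  revert x y
  intro (x : Cochain (leftComplex E') M (n + 1)) (y : Cochain (leftComplex E) M n) _ hxy
  -- The equation `δ x' = x` follows from the other one, since precomposition with the epimorphism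
  -- `φ` is injective.
  suffices ∃ (x' : Cochain (leftComplex E') M n) (y' : Cochain (leftComplex E) M (n - 1)),
      (Cochain.ofHom φ).comp x' (zero_add n) + δ (n - 1) n y' = y by
    obtain ⟨x', y', h⟩ := this
    refine ⟨x', y', hinj ?_, h⟩
    refine Eq.trans ?_ hxy.symm
    refine (δ_ofHom_comp φ x' (n + 1)).symm.trans ?_
    rw [← h, δ_add, δ_δ, add_zero]
  obtain ⟨h, hh⟩ := hM n (ι ≫ y.v 0 n (zero_add n))
  obtain ⟨y', -, hy'⟩ := Cochain.exists_δ_v_eq (n - 1) n (by omega) h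
  let y'' := y - δ (n - 1) n y'
  have h0 : ι ≫ y''.v 0 n (zero_add n) = 0 := by
    rw [Cochain.sub_v, hy', Preadditive.comp_sub, ← hh, Category.assoc, sub_self]
  obtain ⟨g, hg⟩ := hι.desc₀ _ h0
  have hδ : δ n (n + 1) y'' = (Cochain.ofHom φ).comp x (zero_add _) := by
    rw [δ_sub, δ_δ, sub_zero, hxy]
  -- Degree 1 needs no further correction: `δ y''` comes from `E'`, so it vanishes on `T`, and so
  -- does its summand through `y''.v 0`.
  have h1 : (ι ≫ (leftComplex E).d 0 1) ≫ y''.v 1 (n + 1) (by omega) = 0 := by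
    have := Cochain.congr_v hδ 0 (n + 1) (by omega)
    rw [δ_v n (n + 1) rfl _ 0 (n + 1) (by omega) n 1 (by omega) rfl] at this
    have h2 := congrArg (ι ≫ ·) this
    rw [Preadditive.comp_add, reassoc_of% h0, Limits.zero_comp, zero_add, Linear.comp_units_smul,
      Cochain.zero_cochain_comp_v, Cochain.ofHom_v, reassoc_of% hι.comp_eq_zero, Limits.zero_comp] at h2
    have h3 := congrArg ((n + 1).negOnePow • ·) h2
    rw [Category.assoc]
    simpa only [smul_smul, Int.units_mul_self, one_smul, smul_zero] using h3
  obtain ⟨x', hx'⟩ : ∃ x' : Cochain (leftComplex E') M n,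
      (Cochain.ofHom φ).comp x' (zero_add n) = y'' := by
    refine Cochain.exists_ofHom_comp_eq φ y'' fun p q hpq => ?_
    by_cases hp : p = 0
    · obtain rfl : q = n := by omega
      subst hp
      exact ⟨g, hg⟩
    · by_cases hp' : p = 1
      · obtain rfl : q = n + 1 := by omega
        subst hp'
        exact hι.desc₁ _ h1
      · exact ⟨0, (hι.isZero p hp hp').eq_of_src _ _⟩
  refine ⟨x', y', ?_⟩
  rw [hx']
  exact sub_add_cancel _ _

end

/-! ### Evaluation at the central elements: from `Hom(E, -)` to the completion. -/

section CompletionComparison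

open CochainComplex HomComplex MulOpposite

variable {𝕂 : Type t} [CommRing 𝕂] {A : Type u} [Ring A] [Algebra 𝕂 A]
  {E : CochainComplex (ModuleCat.{u} (A ⊗[𝕂] Aᵐᵒᵖ)) ℤ} {s : A}

lemma smul_mem_powSMul (s : A) (n : ℕ) {M : Type u} [AddCommGroup M] [Module A M] (x : M) :
    s ^ n • x ∈ powSMul s M n :=
  Submodule.subset_span ⟨x, rfl⟩

namespace TelescopeBasis

variable (b : TelescopeBasis E s)

lemma central_sub_central_mem (k l : ℕ) (h : k ≤ l) :
    b.central k - b.central l ∈ powSMul s ((leftComplex E).X 0) k := by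
  induction l, h using Nat.le_induction with
  | base => simp
  | succ l h ih =>
    rw [← sub_add_sub_cancel _ (b.central l)]
    refine add_mem ih ?_
    rw [b.central_sub]
    exact powSMul_antitone s _ h (smul_mem_powSMul s l _)

/-- The evaluation of a linear map at the central elements, as an element of a completion. -/
noncomputable def evalCentral {M : ModuleCat.{u} A} (f : (leftComplex E).X 0 ⟶ M) :
    completionSubmodule s M :=
  ⟨fun k => Submodule.Quotient.mk (f.hom (b.central k)), fun k l h => by
    have h' : f.hom (b.central k) - f.hom (b.central l) ∈ powSMul s M k := by
      rw [← map_sub]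
      exact powSMul_le_comap f.hom k (b.central_sub_central_mem k l h)
    exact ((Submodule.Quotient.eq _).2 h').symm⟩

lemma evalCentral_add {M : ModuleCat.{u} A} (f g : (leftComplex E).X 0 ⟶ M) :
    b.evalCentral (f + g) = b.evalCentral f + b.evalCentral g := rfl

lemma evalCentral_sub {M : ModuleCat.{u} A} (f g : (leftComplex E).X 0 ⟶ M) :
    b.evalCentral (f - g) = b.evalCentral f - b.evalCentral g := rfl

lemma evalCentral_comp {M N : ModuleCat.{u} A} (f : (leftComplex E).X 0 ⟶ M) (g : M ⟶ N) :
    b.evalCentral (f ≫ g) = completionMap s g.hom (b.evalCentral f) := rfl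

/-- Centrality enters here: `(a f)(b_k) = f(b_k a) = f(a b_k) = a f(b_k)`. -/
lemma evalCentral_rightMul_comp {M : ModuleCat.{u} A} (f : (leftComplex E).X 0 ⟶ M) (a : A) :
    b.evalCentral ((rightMul E a).f 0 ≫ f) = a • b.evalCentral f := by
  refine Subtype.ext (funext fun k => congrArg Submodule.Quotient.mk ?_)
  exact (congrArg f.hom (b.rightMul_central a k)).trans (map_smul f.hom a _)

/-- The `k`-th term of the sequence is a value at `d b_k`, a multiple of `s ^ k`. Evaluation in
degree 0 is a map of complexes for this reason. -/
lemma evalCentral_d_comp {M : ModuleCat.{u} A} (f : (leftComplex E).X 1 ⟶ M) :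
    b.evalCentral ((leftComplex E).d 0 1 ≫ f) = 0 := by
  refine Subtype.ext (funext fun k => (Submodule.Quotient.mk_eq_zero _).2 ?_)
  have h : ((leftComplex E).d 0 1).hom (b.central k) ∈ powSMul s _ k := by
    rw [b.d_central]
    exact smul_mem_powSMul s k _
  exact powSMul_le_comap f.hom k h

lemma evalCentral_surjective (hn : IsNormalElement s) {M : ModuleCat.{u} A}
    (x : completionSubmodule s M) : ∃ f, b.evalCentral f = x := by
  choose m hm using fun k => Submodule.Quotient.mk_surjective _ (x.1 k)
  have h (k : ℕ) : ∃ r : M, s ^ k • r = m k - m (k + 1) := by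
    rw [← mem_powSMul hn, ← Submodule.Quotient.eq, hm, ← x.2 k (k + 1) k.le_succ, ← hm]
    rfl
  choose r hr using h
  -- These values are forced by `f b_k = m k`, up to torsion: `b_0` is the first generator, and `b_k
  -- - b_{k+1}` is `s ^ k` times the generator `some k`.
  obtain ⟨f, hf⟩ := b.free₀.exists_hom (M := M) (fun i => i.elim (m 0) r)
  have key (k : ℕ) : f.hom (b.central k) = m k := by
    induction k with
    | zero => rw [b.central_zero, hf]; rfl
    | succ k ih =>
      have := congrArg f.hom (b.central_sub k)
      rw [map_sub, ih, map_smul, hf] at this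
      have h2 := this.trans (hr k)
      exact sub_right_injective h2
  refine ⟨f, Subtype.ext (funext fun k => ?_)⟩
  exact (congrArg Submodule.Quotient.mk (key k)).trans (hm k)

/-- Modules without `s`-torsion. -/
def _root_.torsionFreeProperty (s : A) : ObjectProperty (ModuleCat.{u} A) :=
  fun M => ∀ x : M, s • x = 0 → x = 0

lemma _root_.eq_zero_of_pow_smul_eq_zero {M : ModuleCat.{u} A} (hM : torsionFreeProperty s M)
    (k : ℕ) (x : M) (hx : s ^ k • x = 0) : x = 0 := by
  induction k with
  | zero => simpa using hx
  | succ k ih => exact ih (hM _ (by rwa [smul_smul, ← pow_succ']))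

/-- The image of the differential contains an `s`-power multiple of each basis element, which is
enough to detect maps to a torsion-free module. -/
lemma eq_zero_of_d_comp_eq_zero (b : TelescopeBasis E s) {M : ModuleCat.{u} A}
    (hM : torsionFreeProperty s M)
    (g : (leftComplex E).X 1 ⟶ M) (hg : (leftComplex E).d 0 1 ≫ g = 0) : g = 0 := by
  refine b.free₁.hom_ext fun k => ?_
  refine eq_zero_of_pow_smul_eq_zero hM k _ ?_
  rw [← map_smul, ← b.d_central]
  exact congrArg (fun f => f.hom (b.central k)) hg

/-- Vanishing in the completion means `f b_k = s ^ k r k`; the map `g` with values `r` makes `d ≫ g`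
and `f` agree on the `b_k`. These span `E⁰` only up to `s`-power multiples, and torsion-freeness
does the rest. -/
lemma exists_d_comp_eq (hn : IsNormalElement s) {M : ModuleCat.{u} A}
    (hM : torsionFreeProperty s M) (f : (leftComplex E).X 0 ⟶ M) (hf : b.evalCentral f = 0) :
    ∃ g, (leftComplex E).d 0 1 ≫ g = f := by
  have h (k : ℕ) : ∃ r : M, s ^ k • r = f.hom (b.central k) := by
    rw [← mem_powSMul hn, ← Submodule.Quotient.mk_eq_zero]
    exact congrFun (congrArg Subtype.val hf) k
  choose r hr using h
  obtain ⟨g, hg⟩ := b.free₁.exists_hom r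
  have key (k : ℕ) : ((leftComplex E).d 0 1 ≫ g).hom (b.central k) = f.hom (b.central k) := by
    refine (congrArg g.hom (b.d_central k)).trans ?_
    rw [map_smul, hg, hr]
  refine ⟨g, b.free₀.hom_ext fun i => ?_⟩
  cases i with
  | none => rw [← b.central_zero, key]
  | some k =>
    rw [← sub_eq_zero]
    refine eq_zero_of_pow_smul_eq_zero hM k _ ?_
    rw [smul_sub, ← map_smul, ← map_smul, ← b.central_sub, map_sub, map_sub, key, key, sub_self]

/-- The natural transformation from `Hom(E, -)` to the completion functor, given by the
evaluation at the central elements. -/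
noncomputable def homComplexToCompletion :
    homComplexFunctor E ⟶ (completionFunctor s).mapHomologicalComplex (ComplexShape.up ℤ) where
  app M :=
    { f := fun n => ModuleCat.ofHom
        (X := Cochain (leftComplex E) M n) (Y := completionSubmodule s (M.X n))
        { toFun := fun z => b.evalCentral (z.v 0 n (zero_add n))
          map_add' := fun z z' => rfl
          map_smul' := fun a z => by
            rw [homCochain_smul_def, Cochain.zero_cochain_comp_v, Cochain.ofHom_v]
            exact b.evalCentral_rightMul_comp _ a }
      comm' := fun i j hij => by
        obtain rfl : i + 1 = j := hij
        refine ModuleCat.hom_ext (LinearMap.ext ?_)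
        intro (z : Cochain (leftComplex E) M i)
        change completionMap s (M.d i (i + 1)).hom (b.evalCentral (z.v 0 i (zero_add i))) =
          b.evalCentral ((δ i (i + 1) z).v 0 (i + 1) (zero_add _))
        rw [δ_v i (i + 1) rfl _ 0 (i + 1) (zero_add _) i 1 (by omega) rfl, evalCentral_add,
          ← Linear.comp_units_smul, evalCentral_d_comp, add_zero, evalCentral_comp] }
  naturality M N f := by
    ext n : 1
    refine ModuleCat.hom_ext (LinearMap.ext ?_)
    intro (z : Cochain (leftComplex E) M n)
    change b.evalCentral ((z.comp (Cochain.ofHom f) (add_zero n)).v 0 n (zero_add n)) =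
      completionMap s (f.f n).hom (b.evalCentral (z.v 0 n (zero_add n)))
    rw [Cochain.comp_zero_cochain_v, Cochain.ofHom_v, evalCentral_comp]

instance homComplexToCompletion_commShift : NatTrans.CommShift b.homComplexToCompletion ℤ where
  shift_comm a := by
    refine NatTrans.ext (funext fun M => ?_)
    ext n : 1
    refine ModuleCat.hom_ext (LinearMap.ext ?_)
    intro (z : Cochain (leftComplex E) (M⟦a⟧) n)
    have h : b.evalCentral ((z.rightUnshift (n + a) rfl).v 0 (n + a) (zero_add _)) =
        b.evalCentral (z.v 0 n (zero_add n)) := by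
      rw [Cochain.rightUnshift_v _ _ _ 0 (n + a) (zero_add _) n (zero_add n)]
      congr 1
    exact h

/-- For each torsion-free module `N`, the preceding lemmas give the exact sequence `0 → Hom(E¹, N) →
Hom(E⁰, N) → Λ N → 0`. -/
lemma quasiIso_homComplexToCompletion (hn : IsNormalElement s)
    (M : CochainComplex (ModuleCat.{u} A) ℤ) (hM : ∀ n, torsionFreeProperty s (M.X n)) :
    QuasiIso (b.homComplexToCompletion.app M) := by
  refine CochainComplex.quasiIso_of_forall_exists _ fun n x y hx hxy => ?_
  revert x y
  intro (x : Cochain (leftComplex E) M (n + 1)) (y : completionSubmodule s (M.X n)) hx hxy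
  replace hx : δ (n + 1) (n + 1 + 1) x = 0 := hx
  replace hxy : b.evalCentral (x.v 0 (n + 1) (zero_add _)) =
    completionMap s (M.d n (n + 1)).hom y := hxy
  obtain ⟨f, rfl⟩ := b.evalCentral_surjective hn y
  let z : Cochain (leftComplex E) M n := Cochain.single f n
  have hz : (z.v 0 n (zero_add n)) = f := Cochain.single_v f n _
  have hz' : b.evalCentral ((x - δ n (n + 1) z).v 0 (n + 1) (zero_add _)) = 0 := by
    rw [Cochain.sub_v, evalCentral_sub, hxy,
      δ_v n (n + 1) rfl _ 0 (n + 1) (zero_add _) n 1 (by omega) rfl, evalCentral_add,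
      ← Linear.comp_units_smul, evalCentral_d_comp, add_zero, evalCentral_comp, hz, sub_self]
  obtain ⟨g, hg⟩ := b.exists_d_comp_eq hn (hM _) _ hz'
  -- Adding `w` leaves the evaluation of `z` unchanged and makes the component at `0` of `x - δ (z +
  -- w)` vanish. Being a cocycle, this cochain then has a component at `1` killed by precomposition
  -- with `d`, hence zero.
  obtain ⟨w, hw₀, hw⟩ := Cochain.exists_δ_v_eq n (n + 1) rfl g
  have h0 : (x - δ n (n + 1) (z + w)).v 0 (n + 1) (zero_add _) = 0 := by
    rw [δ_add, ← sub_sub, Cochain.sub_v, ← hg, hw, sub_self]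
  have hδ : δ (n + 1) (n + 1 + 1) (x - δ n (n + 1) (z + w)) = 0 := by
    rw [δ_sub, hx, δ_δ, sub_zero]
  have h1 : (x - δ n (n + 1) (z + w)).v 1 (n + 1 + 1) (by omega) = 0 := by
    refine b.eq_zero_of_d_comp_eq_zero (hM _) _ ?_
    have h2 := Cochain.congr_v hδ 0 (n + 1 + 1) (by omega)
    rw [δ_v (n + 1) (n + 1 + 1) rfl _ 0 (n + 1 + 1) (by omega) (n + 1) 1 (by omega) rfl, h0,
      Limits.zero_comp, zero_add, Cochain.zero_v] at h2
    have h3 := congrArg ((n + 1 + 1).negOnePow • ·) h2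
    simpa only [smul_smul, Int.units_mul_self, one_smul, smul_zero] using h3
  refine ⟨z + w, 0, ?_, ?_⟩
  · refine (sub_eq_zero.1 (Cochain.ext _ _ fun p q hpq => ?_)).symm
    by_cases hp : p = 0
    · obtain rfl : q = n + 1 := by omega
      subst hp
      exact h0
    · by_cases hp' : p = 1
      · obtain rfl : q = n + 1 + 1 := by omega
        subst hp'
        exact h1
      · exact (b.isZero p hp hp').eq_of_src _ _
  · rw [map_zero, add_zero]
    change b.evalCentral ((z + w).v 0 n (zero_add n)) = b.evalCentral f
    rw [Cochain.add_v, hw₀, add_zero, hz]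

/-- The natural transformation from `Hom(E, -)` to the completion functor, on the homotopy
category. -/
noncomputable def homHomotopyToCompletion :
    homHomotopyFunctor E ⟶ (completionFunctor s).mapHomotopyCategory (ComplexShape.up ℤ) :=
  Quotient.liftNatTrans _ _ (Functor.whiskerRight b.homComplexToCompletion
    (HomotopyCategory.quotient (ModuleCat.{u} A) (ComplexShape.up ℤ)))

lemma homHomotopyToCompletion_app (M : CochainComplex (ModuleCat.{u} A) ℤ) :
    b.homHomotopyToCompletion.app ((HomotopyCategory.quotient _ _).obj M) =
      (HomotopyCategory.quotient _ _).map (b.homComplexToCompletion.app M) :=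
  Quotient.liftNatTrans_app _ _ _ _

instance : NatTrans.CommShift b.homHomotopyToCompletion ℤ :=
  Quotient.liftNatTrans_commShift _ _ _

end TelescopeBasis

end CompletionComparison

/-! ### Modules adapted to `Λ` and to `Hom(K, -)`; the kernel of the telescope projection. -/

section Resolutions

open MulOpposite Limits

lemma ModuleCat.exists_comp_eq {A : Type u} [Ring A] {X Y M : ModuleCat.{u} A} (e : X ⟶ Y) [Epi e]
    (g : X ⟶ M) (h : ∀ x, e.hom x = 0 → g.hom x = 0) : ∃ g', e ≫ g' = g := by
  have he : Function.Surjective e.hom := (ModuleCat.epi_iff_surjective e).1 inferInstance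
  refine ⟨ModuleCat.ofHom ((LinearMap.ker e.hom).liftQ g.hom h ∘ₗ
    (e.hom.quotKerEquivOfSurjective he).symm.toLinearMap), ?_⟩
  refine ModuleCat.hom_ext (LinearMap.ext fun x => ?_)
  change (LinearMap.ker e.hom).liftQ g.hom h ((e.hom.quotKerEquivOfSurjective he).symm (e.hom x)) = _
  have : (e.hom.quotKerEquivOfSurjective he).symm (e.hom x) =
      Submodule.Quotient.mk x := by
    rw [LinearEquiv.symm_apply_eq]
    rfl
  rw [this]
  rfl

section

variable {A : Type u} [Ring A]

instance (s : A) : (torsionFreeProperty s).IsClosedUnderSubobjects where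
  prop_of_mono {M N} i _ hN x hx := by
    have hi : Function.Injective i.hom := (ModuleCat.mono_iff_injective i).1 inferInstance
    apply hi
    rw [map_zero]
    exact hN _ (by rw [← map_smul, hx, map_zero])

lemma torsionFreeProperty_biprod (s : A) (M N : ModuleCat.{u} A) (hM : torsionFreeProperty s M)
    (hN : torsionFreeProperty s N) : torsionFreeProperty s (M ⊞ N) := by
  intro x hx
  have h₁ : (biprod.fst : M ⊞ N ⟶ M).hom x = 0 := hM _ (by rw [← map_smul, hx, map_zero])
  have h₂ : (biprod.snd : M ⊞ N ⟶ N).hom x = 0 := hN _ (by rw [← map_smul, hx, map_zero])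
  have h := congrArg (fun f => f.hom x) (biprod.total (X := M) (Y := N))
  refine h.symm.trans ?_
  change (biprod.inl : M ⟶ M ⊞ N).hom ((biprod.fst : M ⊞ N ⟶ M).hom x) +
    (biprod.inr : N ⟶ M ⊞ N).hom ((biprod.snd : M ⊞ N ⟶ N).hom x) = 0
  rw [h₁, h₂, map_zero, map_zero, add_zero]

lemma exists_epi_torsionFree {s : A} (hs : IsLeftRegular s) (M : ModuleCat.{u} A) :
    ∃ (N : ModuleCat.{u} A) (p : N ⟶ M), torsionFreeProperty s N ∧ Epi p := by
  refine ⟨ModuleCat.of A (M →₀ A), ModuleCat.ofHom (Finsupp.linearCombination A id), ?_, ?_⟩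
  · intro (x : M →₀ A) hx
    ext m
    apply hs
    have := DFunLike.congr_fun hx m
    simpa using this
  · rw [ModuleCat.epi_iff_surjective]
    exact Finsupp.linearCombination_id_surjective A M

variable {T U : ModuleCat.{u} A} (j : T ⟶ U)

/-- A map from the projective `T` to a quotient of `M` lifts to `M`, and is extended there. This
closure is what keeps right resolutions at length one. -/
lemma extensionProperty_isClosedUnderQuotients [Projective T] :
    (extensionProperty j).IsClosedUnderQuotients where
  prop_of_epi {M N} p _ hM g := by
    obtain ⟨h, hh⟩ := hM (Projective.factorThru g p)
    exact ⟨h ≫ p, by rw [reassoc_of% hh, Projective.factorThru_comp]⟩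

lemma extensionProperty_biprod (M N : ModuleCat.{u} A) (hM : extensionProperty j M)
    (hN : extensionProperty j N) : extensionProperty j (M ⊞ N) := by
  intro g
  obtain ⟨h₁, hh₁⟩ := hM (g ≫ biprod.fst)
  obtain ⟨h₂, hh₂⟩ := hN (g ≫ biprod.snd)
  exact ⟨biprod.lift h₁ h₂, biprod.hom_ext _ _ (by simp [hh₁]) (by simp [hh₂])⟩

lemma exists_mono_extensionProperty [Mono j] (M : ModuleCat.{u} A) :
    ∃ (N : ModuleCat.{u} A) (i : M ⟶ N), extensionProperty j N ∧ Mono i :=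
  ⟨Injective.under M, Injective.ι M,
    fun g => ⟨Injective.factorThru g j, Injective.comp_factorThru g j⟩, inferInstance⟩

end

variable {𝕂 : Type t} [CommRing 𝕂] {A : Type u} [Ring A] [Algebra 𝕂 A]
  {B : Type u} [Ring B] [Algebra 𝕂 B] (f : A →ₐ[𝕂] B) {s : A} (hn : IsNormalElement s)

lemma epi_restrictScalars_map {M N : ModuleCat.{u} (A ⊗[𝕂] Aᵐᵒᵖ)} (p : M ⟶ N) [Epi p] :
    Epi ((ModuleCat.restrictScalars.{u} (toEnveloping 𝕂 A)).map p) := by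
  rw [ModuleCat.epi_iff_surjective]
  exact (ModuleCat.epi_iff_surjective p).1 inferInstance

/-- The inclusion of the kernel of the projection of the telescope complex in degree `0`. -/
noncomputable def leftTelescopeι : leftFractionSum f hn ⟶ (leftTelescope f hn).X 0 :=
  (ModuleCat.restrictScalars.{u} (toEnveloping 𝕂 A)).map (ModuleCat.ofHom
    (LinearMap.inr (A ⊗[𝕂] Aᵐᵒᵖ) (bimodule 𝕂 (AlgHom.id 𝕂 A)) (fractionSum f hn))) ≫
    (leftTelescopeX₀ f hn).hom

lemma leftTelescopeι_d_hom_apply (t : leftFractionSum f hn) :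
    (leftTelescopeι f hn ≫ (leftTelescope f hn).d 0 1).hom t =
      (leftTelescopeX₁ f hn).hom.hom (telescopeMap f hn t) := by
  rw [leftTelescopeι, Category.assoc, leftTelescopeX₀_hom_d]
  change (leftTelescopeX₁ f hn).hom.hom
    (fractionSum.incl f hn 0 (toFractionSubmoduleZero f hn 0) + telescopeMap f hn t) = _
  rw [map_zero, map_zero, zero_add]

instance mono_leftTelescopeι_d : Mono (leftTelescopeι f hn ≫ (leftTelescope f hn).d 0 1) := by
  rw [ModuleCat.mono_iff_injective]
  intro t t' h
  rw [leftTelescopeι_d_hom_apply, leftTelescopeι_d_hom_apply] at h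
  exact telescopeMap_injective f hn
    ((ModuleCat.mono_iff_injective (leftTelescopeX₁ f hn).hom).1 inferInstance h)

lemma leftTelescopeX₀_hom_leftComplexMap :
    (leftTelescopeX₀ f hn).hom ≫ (leftComplexMap (telescopeProj f hn)).f 0 =
      (ModuleCat.restrictScalars.{u} (toEnveloping 𝕂 A)).map
        (ModuleCat.ofHom (LinearMap.fst (A ⊗[𝕂] Aᵐᵒᵖ) (bimodule 𝕂 (AlgHom.id 𝕂 A))
          (fractionSum f hn)) ≫ (HomologicalComplex.doubleXIso₀ _ _).inv) := by
  change (ModuleCat.restrictScalars.{u} (toEnveloping 𝕂 A)).map _ ≫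
    (ModuleCat.restrictScalars.{u} (toEnveloping 𝕂 A)).map ((telescopeProj f hn).f 0) = _
  rw [← Functor.map_comp]
  congr 1
  refine (congrArg _ (HomologicalComplex.mkHomFromDouble_f₀ _ _ _ _ _ _)).trans ?_
  exact Iso.inv_hom_id_assoc _ _

lemma leftTelescopeX₁_hom_leftComplexMap :
    (leftTelescopeX₁ f hn).hom ≫ (leftComplexMap (telescopeProj f hn)).f 1 =
      (ModuleCat.restrictScalars.{u} (toEnveloping 𝕂 A)).map
        (ModuleCat.ofHom (fractionSum.sum f hn) ≫
          (HomologicalComplex.doubleXIso₁ _ _ zero_ne_one).inv) := by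
  change (ModuleCat.restrictScalars.{u} (toEnveloping 𝕂 A)).map _ ≫
    (ModuleCat.restrictScalars.{u} (toEnveloping 𝕂 A)).map ((telescopeProj f hn).f 1) = _
  rw [← Functor.map_comp]
  congr 1
  refine (congrArg _ (HomologicalComplex.mkHomFromDouble_f₁ _ _ _ _ _ _)).trans ?_
  exact Iso.inv_hom_id_assoc _ _

/-- The kernel in degree 0 is the summand `⨁ A s⁻ⁿ`. In degree 1 it is the kernel of the summation
map, which is the image of that summand under the telescope map. -/
lemma twoTermKernel_telescopeProj (hB : ∀ x : B, ∃ (n : ℕ) (a : A), x * f s ^ n = f a) :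
    TwoTermKernel (leftComplexMap (telescopeProj f hn)) (leftTelescopeι f hn) := by
  have h₀ : Epi ((leftComplexMap (telescopeProj f hn)).f 0) := by
    have : Epi (ModuleCat.ofHom (LinearMap.fst (A ⊗[𝕂] Aᵐᵒᵖ) (bimodule 𝕂 (AlgHom.id 𝕂 A))
        (fractionSum f hn))) := (ModuleCat.epi_iff_surjective _).2 Prod.fst_surjective
    have := epi_restrictScalars_map (ModuleCat.ofHom (LinearMap.fst (A ⊗[𝕂] Aᵐᵒᵖ)
      (bimodule 𝕂 (AlgHom.id 𝕂 A)) (fractionSum f hn)) ≫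
        (HomologicalComplex.doubleXIso₀ (bimoduleMap 𝕂 f)
          (show (ComplexShape.up ℤ).Rel 0 1 by simp)).inv)
    exact @epi_of_epi_fac _ _ _ _ _ _ _ _ this (leftTelescopeX₀_hom_leftComplexMap f hn)
  have h₁ : Epi ((leftComplexMap (telescopeProj f hn)).f 1) := by
    have : Epi (ModuleCat.ofHom (fractionSum.sum f hn)) :=
      (ModuleCat.epi_iff_surjective _).2 (fractionSum.sum_surjective f hn hB)
    have := epi_restrictScalars_map (ModuleCat.ofHom (fractionSum.sum f hn) ≫
      (HomologicalComplex.doubleXIso₁ (bimoduleMap 𝕂 f)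
        (show (ComplexShape.up ℤ).Rel 0 1 by simp) zero_ne_one).inv)
    exact @epi_of_epi_fac _ _ _ _ _ _ _ _ this (leftTelescopeX₁_hom_leftComplexMap f hn)
  refine ⟨isZero_leftTelescope_X f hn, fun n => ?_, ?_, fun {M} g hg => ?_, fun {M} g hg => ?_⟩
  · by_cases hn₀ : n = 0
    · subst hn₀
      exact h₀
    · by_cases hn₁ : n = 1
      · subst hn₁
        exact h₁
      · have hz : IsZero ((leftComplex (HomologicalComplex.double (bimoduleMap 𝕂 f)
            (show (ComplexShape.up ℤ).Rel 0 1 by simp))).X n) :=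
          (ModuleCat.restrictScalars.{u} (toEnveloping 𝕂 A)).map_isZero
            (HomologicalComplex.isZero_double_X _ _ n hn₀ hn₁)
        exact ⟨fun _ _ _ => hz.eq_of_src _ _⟩
  · rw [leftTelescopeι, Category.assoc, leftTelescopeX₀_hom_leftComplexMap]
    refine ModuleCat.hom_ext (LinearMap.ext fun t => ?_)
    exact map_zero (HomologicalComplex.doubleXIso₀ (bimoduleMap 𝕂 f)
      (show (ComplexShape.up ℤ).Rel 0 1 by simp)).inv.hom
  · refine ModuleCat.exists_comp_eq _ g fun x hx => ?_
    obtain ⟨y, rfl⟩ := (ModuleCat.epi_iff_surjective (leftTelescopeX₀ f hn).hom).1 inferInstance x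
    have h := CochainComplex.hom_apply_congr (leftTelescopeX₀_hom_leftComplexMap f hn) y
    have h' : y.1 = 0 := (ModuleCat.mono_iff_injective (HomologicalComplex.doubleXIso₀
      (bimoduleMap 𝕂 f) (show (ComplexShape.up ℤ).Rel 0 1 by simp)).inv).1 inferInstance
        ((h.symm.trans hx).trans (map_zero _).symm)
    have h'' : y = (((0, y.2) : bimodule 𝕂 (AlgHom.id 𝕂 A) × fractionSum f hn)) := Prod.ext h' rfl
    rw [h'']
    exact CochainComplex.hom_apply_congr hg y.2
  · refine ModuleCat.exists_comp_eq _ g fun x hx => ?_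
    obtain ⟨y, rfl⟩ := (ModuleCat.epi_iff_surjective (leftTelescopeX₁ f hn).hom).1 inferInstance x
    have h := CochainComplex.hom_apply_congr (leftTelescopeX₁_hom_leftComplexMap f hn) y
    have h' : fractionSum.sum f hn y = 0 := (ModuleCat.mono_iff_injective
      (HomologicalComplex.doubleXIso₁ (bimoduleMap 𝕂 f)
        (show (ComplexShape.up ℤ).Rel 0 1 by simp) zero_ne_one).inv).1 inferInstance
          ((h.symm.trans hx).trans (map_zero _).symm)
    obtain ⟨t, rfl⟩ := exists_telescopeMap_eq_of_sum_eq_zero f hn y h'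
    exact (congrArg g.hom (leftTelescopeι_d_hom_apply f hn t).symm).trans
      (CochainComplex.hom_apply_congr hg t)

end Resolutions

/-! ### Transporting triangulatedness along a natural transformation. -/

section TriangulatedComparison

open Limits Pretriangulated

namespace CategoryTheory.Pretriangulated

variable {C D : Type*} [Category C] [Category D] [HasShift C ℤ] [HasShift D ℤ]
  {F G : C ⥤ D} [F.CommShift ℤ] [G.CommShift ℤ] (τ : F ⟶ G) [NatTrans.CommShift τ ℤ]

/-- The isomorphism between the images of a triangle induced by a natural transformation which is
compatible with the shifts and which is an isomorphism on the objects of the triangle. -/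
noncomputable def natTransMapTriangleIso (T : Triangle C) [IsIso (τ.app T.obj₁)]
    [IsIso (τ.app T.obj₂)] [IsIso (τ.app T.obj₃)] :
    F.mapTriangle.obj T ≅ G.mapTriangle.obj T :=
  let e₁ : F.obj T.obj₁ ≅ G.obj T.obj₁ := asIso (τ.app T.obj₁)
  let e₂ : F.obj T.obj₂ ≅ G.obj T.obj₂ := asIso (τ.app T.obj₂)
  let e₃ : F.obj T.obj₃ ≅ G.obj T.obj₃ := asIso (τ.app T.obj₃)
  Triangle.isoMk _ _ e₁ e₂ e₃ (τ.naturality T.mor₁) (τ.naturality T.mor₂) (by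
    change (F.map T.mor₃ ≫ (F.commShiftIso (1 : ℤ)).hom.app T.obj₁) ≫ (τ.app T.obj₁)⟦(1 : ℤ)⟧' =
      τ.app T.obj₃ ≫ G.map T.mor₃ ≫ (G.commShiftIso (1 : ℤ)).hom.app T.obj₁
    rw [Category.assoc, NatTrans.shift_app_comm, τ.naturality_assoc])

end CategoryTheory.Pretriangulated

namespace DerivedCategory

variable {C : Type*} [Category C] [Abelian C] [HasDerivedCategory C]
  {P : ObjectProperty C}

/-- Every morphism in the derived category is isomorphic to the image of a morphism of complexes
with terms in a class of objects having enough left resolutions. -/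
lemma exists_arrow_iso (hP : ∀ M : CochainComplex C ℤ, ∃ (N : CochainComplex C ℤ) (f : N ⟶ M),
      (∀ n, P (N.X n)) ∧ QuasiIso f) {X Y : DerivedCategory C} (f : X ⟶ Y) :
    ∃ (K L : CochainComplex C ℤ) (_ : ∀ n, P (K.X n)) (_ : ∀ n, P (L.X n)) (h : K ⟶ L)
      (e : Q.obj K ≅ X) (e' : Q.obj L ≅ Y), e.hom ≫ f = Q.map h ≫ e'.hom := by
  obtain ⟨L, l, hL, _⟩ := hP (Q.objPreimage Y)
  let e' : Q.obj L ≅ Y := asIso (Q.map l) ≪≫ Q.objObjPreimageIso Y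
  -- The target is resolved before the fraction is chosen, so that its numerator already ends in
  -- `L`; resolving `X'` afterwards only precomposes it.
  obtain ⟨X', s, _, g, hg⟩ := right_fac ((Q.objObjPreimageIso X).hom ≫ f ≫ e'.inv)
  obtain ⟨K, k, hK, _⟩ := hP X'
  refine ⟨K, L, hK, hL, k ≫ g, asIso (Q.map k) ≪≫ asIso (Q.map s) ≪≫ Q.objObjPreimageIso X, e', ?_⟩
  rw [← cancel_mono e'.inv]
  simp [hg]

/-- Each distinguished triangle is isomorphic to the cone triangle of a map between complexes with
terms in `P`. The cone has terms in `P` too, so `τ` identifies the image of that triangle under `F`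
with its image under the triangulated functor `G`. -/
lemma isTriangulated_of_natTrans {D : Type*} [Category D] [Preadditive D] [HasZeroObject D]
    [HasShift D ℤ] [∀ n : ℤ, (shiftFunctor D n).Additive] [Pretriangulated D]
    (F : DerivedCategory C ⥤ D) [F.CommShift ℤ]
    (G : HomotopyCategory C (ComplexShape.up ℤ) ⥤ D) [G.CommShift ℤ] [G.IsTriangulated]
    (τ : Qh ⋙ F ⟶ G) [NatTrans.CommShift τ ℤ]
    [P.IsClosedUnderIsomorphisms] (hP₂ : ∀ X Y, P X → P Y → P (X ⊞ Y))
    (hP : ∀ M : CochainComplex C ℤ, ∃ (N : CochainComplex C ℤ) (f : N ⟶ M),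
      (∀ n, P (N.X n)) ∧ QuasiIso f)
    (hτ : ∀ M : CochainComplex C ℤ, (∀ n, P (M.X n)) →
      IsIso (τ.app ((HomotopyCategory.quotient _ _).obj M))) : F.IsTriangulated where
  map_distinguished T hT := by
    obtain ⟨K, L, hK, hL, h, e, e', comm⟩ := exists_arrow_iso hP T.mor₁
    let S := CochainComplex.mappingCone.triangleh h
    have hS : S ∈ distTriang _ := HomotopyCategory.mappingCone_triangleh_distinguished h
    let i := quotientCompQhIso C
    let iso : Qh.mapTriangle.obj S ≅ T := isoTriangleOfIso₁₂ _ _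
      (Qh.map_distinguished S hS) hT (i.app K ≪≫ e) (i.app L ≪≫ e') (by
        change Qh.map ((HomotopyCategory.quotient _ _).map h) ≫ i.hom.app L ≫ e'.hom =
          (i.hom.app K ≫ e.hom) ≫ T.mor₁
        rw [Category.assoc, comm, quotientCompQhIso_hom_naturality_assoc])
    have : IsIso (τ.app S.obj₁) := hτ K hK
    have : IsIso (τ.app S.obj₂) := hτ L hL
    have : IsIso (τ.app S.obj₃) := hτ _ (CochainComplex.prop_mappingCone_X hP₂ h hK hL)
    refine isomorphic_distinguished _ (G.map_distinguished S hS) _ ?_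
    exact F.mapTriangle.mapIso iso.symm ≪≫ (Functor.mapTriangleCompIso Qh F).symm.app S ≪≫
      natTransMapTriangleIso τ S

end DerivedCategory

end TriangulatedComparison

/-! ### The functor induced by `Hom(E, -)` as both derived functors. -/

section DerivedFunctors

open CochainComplex HomComplex MulOpposite DerivedCategory

variable {𝕂 : Type t} [CommRing 𝕂] {A : Type u} [Ring A] [Algebra 𝕂 A]

section

variable (E : CochainComplex (ModuleCat.{u} (A ⊗[𝕂] Aᵐᵒᵖ)) ℤ)

/-- Scalars pass through the tensor product over `𝕂`, so they act alike on both sides; the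
`𝕂`-linearity of `Hom(E, -)` rests on this. -/
lemma rightMul_algebraMap (r : 𝕂) : rightMul E (algebraMap 𝕂 A r) = r • 𝟙 _ := by
  ext i x
  change ((1 : A) ⊗ₜ[𝕂] op (algebraMap 𝕂 A r)) • (show E.X i from x) =
    (algebraMap 𝕂 A r ⊗ₜ[𝕂] (1 : Aᵐᵒᵖ)) • (show E.X i from x)
  congr 1
  rw [Algebra.algebraMap_eq_smul_one, MulOpposite.op_smul, MulOpposite.op_one,
    TensorProduct.tmul_smul, TensorProduct.smul_tmul']

instance : (homComplexFunctor E).Linear 𝕂 where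
  map_smul {M N} f r := by
    ext n : 1
    refine ModuleCat.hom_ext (LinearMap.ext ?_)
    intro (z : Cochain (leftComplex E) M n)
    change z.comp (Cochain.ofHom (r • f)) (add_zero n) =
      (Cochain.ofHom (rightMul E (algebraMap 𝕂 A r))).comp
        (z.comp (Cochain.ofHom f) (add_zero n)) (zero_add n)
    rw [rightMul_algebraMap]
    ext p q hpq : 1
    rw [Cochain.zero_cochain_comp_v, Cochain.comp_zero_cochain_v, Cochain.comp_zero_cochain_v,
      Cochain.ofHom_v, Cochain.ofHom_v, Cochain.ofHom_v, HomologicalComplex.smul_f_apply,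
      HomologicalComplex.smul_f_apply, Linear.comp_smul, Linear.smul_comp,
      HomologicalComplex.id_f, Category.id_comp]

instance : (homHomotopyFunctor E).Linear 𝕂 :=
  have : (HomotopyCategory.quotient _ _ ⋙ homHomotopyFunctor E).Linear 𝕂 :=
    inferInstanceAs ((homComplexFunctor E ⋙ HomotopyCategory.quotient _ _).Linear 𝕂)
  (HomotopyCategory.quotient _ _).linear_of_full_essSurj_comp (homHomotopyFunctor E)

end

variable [HasDerivedCategory.{w} (ModuleCat.{u} A)]
  {E : CochainComplex (ModuleCat.{u} (A ⊗[𝕂] Aᵐᵒᵖ)) ℤ} {s : A}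

lemma isIso_Qh_map_quotient_map {K L : CochainComplex (ModuleCat.{u} A) ℤ} (f : K ⟶ L)
    [QuasiIso f] : IsIso (Qh.map ((HomotopyCategory.quotient _ _).map f)) :=
  Localization.inverts Qh (HomotopyCategory.quasiIso _ (ComplexShape.up ℤ)) _
    ((HomotopyCategory.quotient_map_mem_quasiIso_iff f).2 (by
      rwa [HomologicalComplex.mem_quasiIso_iff]))

namespace TelescopeBasis

variable (b : TelescopeBasis E s)

include b in
lemma isInvertedBy : (HomotopyCategory.quasiIso (ModuleCat.{u} A) (ComplexShape.up ℤ)).IsInvertedBy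
    (homHomotopyFunctor E ⋙ Qh) := by
  intro X Y f hf
  obtain ⟨K, rfl⟩ := HomotopyCategory.quotient_obj_surjective X
  obtain ⟨L, rfl⟩ := HomotopyCategory.quotient_obj_surjective Y
  obtain ⟨g, rfl⟩ := (HomotopyCategory.quotient _ _).map_surjective f
  rw [HomotopyCategory.quotient_map_mem_quasiIso_iff, HomologicalComplex.mem_quasiIso_iff] at hf
  have := b.quasiIso_homComplexMap g
  exact isIso_Qh_map_quotient_map ((homComplexFunctor E).map g)

/-- The functor on the derived category induced by `Hom(E, -)`. -/
noncomputable def derivedHom :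
    DerivedCategory (ModuleCat.{u} A) ⥤ DerivedCategory (ModuleCat.{u} A) :=
  Localization.lift (homHomotopyFunctor E ⋙ Qh) b.isInvertedBy Qh

noncomputable instance : Localization.Lifting Qh
    (HomotopyCategory.quasiIso (ModuleCat.{u} A) (ComplexShape.up ℤ))
    (homHomotopyFunctor E ⋙ Qh) b.derivedHom :=
  Localization.liftingLift _ _ _

/-- The functor `derivedHom` is induced by `Hom(E, -)`. -/
noncomputable def derivedHomFactors : Qh ⋙ b.derivedHom ≅ homHomotopyFunctor E ⋙ Qh :=
  Localization.Lifting.iso Qh (HomotopyCategory.quasiIso (ModuleCat.{u} A) (ComplexShape.up ℤ))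
    _ _

noncomputable instance : b.derivedHom.CommShift ℤ :=
  Functor.commShiftOfLocalization Qh
    (HomotopyCategory.quasiIso (ModuleCat.{u} A) (ComplexShape.up ℤ)) ℤ
    (homHomotopyFunctor E ⋙ Qh) b.derivedHom

instance : NatTrans.CommShift b.derivedHomFactors.hom ℤ :=
  inferInstanceAs (NatTrans.CommShift (Localization.Lifting.iso Qh
    (HomotopyCategory.quasiIso (ModuleCat.{u} A) (ComplexShape.up ℤ))
    (homHomotopyFunctor E ⋙ Qh) b.derivedHom).hom ℤ)

instance : b.derivedHom.Linear 𝕂 := by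
  rw [← Localization.functor_linear_iff Qh (HomotopyCategory.quasiIso (ModuleCat.{u} A)
    (ComplexShape.up ℤ)) 𝕂 (homHomotopyFunctor E ⋙ Qh)]
  infer_instance

/-- The natural transformation from `Hom(E', -)` to the functor induced by `Hom(E, -)`, for
a map of complexes of bimodules `E ⟶ E'`. -/
noncomputable def derivedHomUnit {E' : CochainComplex (ModuleCat.{u} (A ⊗[𝕂] Aᵐᵒᵖ)) ℤ}
    (π : E ⟶ E') : homHomotopyFunctor E' ⋙ Qh ⟶ Qh ⋙ b.derivedHom :=
  Functor.whiskerRight (homHomotopyPrecomp π) Qh ≫ b.derivedHomFactors.inv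

instance {E' : CochainComplex (ModuleCat.{u} (A ⊗[𝕂] Aᵐᵒᵖ)) ℤ} (π : E ⟶ E') :
    NatTrans.CommShift (b.derivedHomUnit π) ℤ := by
  unfold derivedHomUnit
  infer_instance

lemma isIso_derivedHomUnit_app {E' : CochainComplex (ModuleCat.{u} (A ⊗[𝕂] Aᵐᵒᵖ)) ℤ}
    (π : E ⟶ E') (M : CochainComplex (ModuleCat.{u} A) ℤ)
    [QuasiIso ((homComplexPrecomp π).app M)] :
    IsIso ((b.derivedHomUnit π).app ((HomotopyCategory.quotient _ _).obj M)) := by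
  have h : IsIso (Qh.map ((homHomotopyPrecomp π).app ((HomotopyCategory.quotient _ _).obj M))) := by
    rw [homHomotopyPrecomp_app]
    exact isIso_Qh_map_quotient_map ((homComplexPrecomp π).app M)
  exact IsIso.comp_isIso' h inferInstance

/-- The natural transformation from the functor induced by `Hom(E, -)` to the completion functor. -/
noncomputable def derivedHomCounit : Qh ⋙ b.derivedHom ⟶
    (completionFunctor s).mapHomotopyCategory (ComplexShape.up ℤ) ⋙ Qh :=
  b.derivedHomFactors.hom ≫ Functor.whiskerRight b.homHomotopyToCompletion Qh

instance : NatTrans.CommShift b.derivedHomCounit ℤ := by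
  unfold derivedHomCounit
  infer_instance

lemma isIso_derivedHomCounit_app (M : CochainComplex (ModuleCat.{u} A) ℤ)
    [QuasiIso (b.homComplexToCompletion.app M)] :
    IsIso (b.derivedHomCounit.app ((HomotopyCategory.quotient _ _).obj M)) := by
  have h : IsIso (Qh.map (b.homHomotopyToCompletion.app
      ((HomotopyCategory.quotient _ _).obj M))) := by
    rw [homHomotopyToCompletion_app]
    exact isIso_Qh_map_quotient_map (b.homComplexToCompletion.app M)
  exact IsIso.comp_isIso' inferInstance h

lemma exists_isIso_derivedHomCounit_app (hn : IsNormalElement s) (hs : IsLeftRegular s)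
    (X : HomotopyCategory (ModuleCat.{u} A) (ComplexShape.up ℤ)) : ∃ (X' : _) (w : X' ⟶ X),
      HomotopyCategory.quasiIso _ _ w ∧ IsIso (b.derivedHomCounit.app X') := by
  obtain ⟨M, rfl⟩ := HomotopyCategory.quotient_obj_surjective X
  obtain ⟨N, f, hN, hf⟩ := exists_quasiIso_of_isClosedUnderSubobjects
    (torsionFreeProperty_biprod s) (exists_epi_torsionFree hs) M
  have := b.quasiIso_homComplexToCompletion hn N hN
  exact ⟨_, (HomotopyCategory.quotient _ _).map f,
    (HomotopyCategory.quotient_map_mem_quasiIso_iff f).2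
      ((HomologicalComplex.mem_quasiIso_iff f).2 hf), b.isIso_derivedHomCounit_app N⟩

lemma exists_isIso_derivedHomUnit_app {E' : CochainComplex (ModuleCat.{u} (A ⊗[𝕂] Aᵐᵒᵖ)) ℤ}
    {π : E ⟶ E'} {T : ModuleCat.{u} A} [Projective T] {ι : T ⟶ (leftComplex E).X 0}
    (hι : TwoTermKernel (leftComplexMap π) ι) [Mono (ι ≫ (leftComplex E).d 0 1)]
    (X : HomotopyCategory (ModuleCat.{u} A) (ComplexShape.up ℤ)) : ∃ (X' : _) (w : X ⟶ X'),
      HomotopyCategory.quasiIso _ _ w ∧ IsIso ((b.derivedHomUnit π).app X') := by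
  obtain ⟨M, rfl⟩ := HomotopyCategory.quotient_obj_surjective X
  have := extensionProperty_isClosedUnderQuotients (ι ≫ (leftComplex E).d 0 1)
  obtain ⟨N, f, hN, hf⟩ := exists_quasiIso_of_isClosedUnderQuotients
    (extensionProperty_biprod (ι ≫ (leftComplex E).d 0 1))
    (exists_mono_extensionProperty (ι ≫ (leftComplex E).d 0 1)) M
  have := hι.quasiIso_homComplexPrecomp N hN
  exact ⟨_, (HomotopyCategory.quotient _ _).map f,
    (HomotopyCategory.quotient_map_mem_quasiIso_iff f).2
      ((HomologicalComplex.mem_quasiIso_iff f).2 hf), b.isIso_derivedHomUnit_app π N⟩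

/-- On torsion-free complexes the counit compares this functor with the one induced by the
completion, which is triangulated because it comes from an additive functor. -/
lemma isTriangulated_derivedHom (hn : IsNormalElement s) (hs : IsLeftRegular s) :
    b.derivedHom.IsTriangulated :=
  isTriangulated_of_natTrans b.derivedHom _ b.derivedHomCounit (torsionFreeProperty_biprod s)
    (exists_quasiIso_of_isClosedUnderSubobjects
      (torsionFreeProperty_biprod s) (exists_epi_torsionFree hs)) fun M hM => by
        have := b.quasiIso_homComplexToCompletion hn M hM
        exact b.isIso_derivedHomCounit_app M

/-- The right derived functor of `Hom(E', -)`. -/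
noncomputable def rightDerivedFunctor (hn : IsNormalElement s) (hs : IsLeftRegular s)
    {E' : CochainComplex (ModuleCat.{u} (A ⊗[𝕂] Aᵐᵒᵖ)) ℤ}
    {π : E ⟶ E'} {T : ModuleCat.{u} A} [Projective T] {ι : T ⟶ (leftComplex E).X 0}
    (hι : TwoTermKernel (leftComplexMap π) ι) [Mono (ι ≫ (leftComplex E).d 0 1)] :
    TriangulatedRightDerivedFunctor 𝕂 (homHomotopyFunctor E') where
  functor := b.derivedHom
  commShift := inferInstance
  isTriangulated := b.isTriangulated_derivedHom hn hs
  linear := inferInstance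
  unit := b.derivedHomUnit π
  unit_commShift := inferInstance
  isRightDerived := isRightDerivedFunctor_of_exists_isIso _ _ _
    (b.exists_isIso_derivedHomUnit_app hι)

/-- The left derived functor of the completion functor. -/
noncomputable def leftDerivedFunctor (hn : IsNormalElement s) (hs : IsLeftRegular s) :
    TriangulatedLeftDerivedFunctor 𝕂
      ((completionFunctor s).mapHomotopyCategory (ComplexShape.up ℤ)) where
  functor := b.derivedHom
  commShift := inferInstance
  isTriangulated := b.isTriangulated_derivedHom hn hs
  linear := inferInstance
  counit := b.derivedHomCounit
  counit_commShift := inferInstance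
  isLeftDerived := isLeftDerivedFunctor_of_exists_isIso _ _ _
    (b.exists_isIso_derivedHomCounit_app hn hs)

end TelescopeBasis

end DerivedFunctors

/-! ### The Ore localisation as the union of the `A s⁻ⁿ`. -/

section OreLocalization

variable (𝕂 : Type t) [CommRing 𝕂] {A : Type u} [Ring A] [Algebra 𝕂 A] {s : A}

lemma injective_oreLocalizationAlgHom [OreLocalization.OreSet (Submonoid.powers s)]
    (hs : IsLeftRegular s) :
    Function.Injective (oreLocalizationAlgHom 𝕂 (Submonoid.powers s)) := by
  intro a b h
  obtain ⟨⟨_, n, rfl⟩, v, h₁, h₂⟩ := OreLocalization.oreDiv_eq_iff.1 h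
  simp only [OneMemClass.coe_one, mul_one] at h₂
  subst h₂
  exact (hs.pow n h₁).symm

lemma isUnit_oreLocalizationAlgHom [OreLocalization.OreSet (Submonoid.powers s)] :
    IsUnit (oreLocalizationAlgHom 𝕂 (Submonoid.powers s) s) :=
  OreLocalization.numerator_isUnit (⟨s, Submonoid.mem_powers s⟩ : Submonoid.powers s)

/-- Elements of the localisation are left fractions `s⁻ⁿ r`. Writing `r sⁿ = sⁿ b` by normality
gives `s⁻ⁿ r sⁿ = b`, with the same exponent. -/
lemma exists_mul_pow_eq_oreLocalizationAlgHom (hn : IsNormalElement s)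
    [OreLocalization.OreSet (Submonoid.powers s)]
    (x : OreLocalization (Submonoid.powers s) A) : ∃ (n : ℕ) (a : A),
      x * oreLocalizationAlgHom 𝕂 (Submonoid.powers s) s ^ n =
        oreLocalizationAlgHom 𝕂 (Submonoid.powers s) a := by
  induction x using OreLocalization.ind with
  | _ r d =>
    obtain ⟨_, n, rfl⟩ := d
    obtain ⟨b, hb⟩ := hn.exists_mul_pow n r
    refine ⟨n, b, ?_⟩
    rw [← map_pow]
    change (r /ₒ _) * (s ^ n /ₒ (1 : Submonoid.powers s)) = b /ₒ (1 : Submonoid.powers s)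
    rw [OreLocalization.oreDiv_mul_char r (s ^ n) _ 1 r 1 (by simp), one_mul, hb,
      OreLocalization.expand' b 1 (⟨s ^ n, n, rfl⟩ : Submonoid.powers s), mul_one]
    rfl

end OreLocalization

/-! ### Comparison of arbitrary derived functors, and the theorem. -/

section Uniqueness

variable {𝕂 : Type t} [CommRing 𝕂] {A : Type u} [Ring A] [Algebra 𝕂 A]
  [HasDerivedCategory.{w} (ModuleCat.{u} A)]
  {E E' : CochainComplex (ModuleCat.{u} (A ⊗[𝕂] Aᵐᵒᵖ)) ℤ} {s : A}

/-- A right derived functor of `Hom(E', -)` is isomorphic to a left derived functor of the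
completion functor when `E'` admits a resolution by a telescope complex. -/
lemma TelescopeBasis.exists_iso_commShift (b : TelescopeBasis E s) (hn : IsNormalElement s)
    (hs : IsLeftRegular s)
    {π : E ⟶ E'} {T : ModuleCat.{u} A} [Projective T] {ι : T ⟶ (leftComplex E).X 0}
    (hι : TwoTermKernel (leftComplexMap π) ι) [Mono (ι ≫ (leftComplex E).d 0 1)]
    (R : TriangulatedRightDerivedFunctor 𝕂 (homHomotopyFunctor E'))
    (S : TriangulatedLeftDerivedFunctor 𝕂
      ((completionFunctor s).mapHomotopyCategory (ComplexShape.up ℤ))) :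
    ∃ ω : R.functor ≅ S.functor, NatTrans.CommShift ω.hom ℤ := by
  let W := HomotopyCategory.quasiIso (ModuleCat.{u} A) (ComplexShape.up ℤ)
  have hR := R.isRightDerived
  have hS := S.isLeftDerived
  have hR₀ : b.derivedHom.IsRightDerivedFunctor (b.derivedHomUnit π) W :=
    (b.rightDerivedFunctor hn hs hι).isRightDerived
  have hS₀ : b.derivedHom.IsLeftDerivedFunctor b.derivedHomCounit W :=
    (b.leftDerivedFunctor hn hs).isLeftDerived
  let e : b.derivedHom ≅ R.functor :=
    Functor.rightDerivedUnique b.derivedHom R.functor (b.derivedHomUnit π) R.unit W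
  let e' : S.functor ≅ b.derivedHom :=
    Functor.leftDerivedUnique b.derivedHom S.functor S.counit b.derivedHomCounit W
  -- Uniqueness of derived functors only provides natural isomorphisms. Compatibility with shifts
  -- follows because `e.hom` carries one shift-compatible unit to another, and the first is
  -- invertible on enough objects.
  have he : NatTrans.CommShift e.hom ℤ := by
    have h : b.derivedHomUnit π ≫ Functor.whiskerLeft _ e.hom = R.unit :=
      (Functor.rightDerivedNatTrans_fac _ _ _ _ W _).trans (Category.id_comp _)
    have : NatTrans.CommShift (b.derivedHomUnit π ≫ Functor.whiskerLeft _ e.hom) ℤ := by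
      rw [h]
      exact R.unit_commShift
    exact commShift_of_exists_isIso _ W (b.derivedHomUnit π) ℤ e.hom
      (b.exists_isIso_derivedHomUnit_app hι)
  have he' : NatTrans.CommShift e'.hom ℤ := by
    have h : Functor.whiskerLeft _ e'.hom ≫ b.derivedHomCounit = S.counit :=
      (Functor.leftDerivedNatTrans_fac _ _ _ _ W _).trans (Category.comp_id _)
    have : NatTrans.CommShift (Functor.whiskerLeft _ e'.hom ≫ b.derivedHomCounit) ℤ := by
      rw [h]
      exact S.counit_commShift
    exact commShift_of_exists_isIso' _ W b.derivedHomCounit ℤ e'.hom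
      (b.exists_isIso_derivedHomCounit_app hn hs)
  refine ⟨e.symm ≪≫ e'.symm, ?_⟩
  change NatTrans.CommShift (e.inv ≫ e'.inv) ℤ
  infer_instance

end Uniqueness

theorem theorem5p4 {𝕂 : Type t} [CommRing 𝕂] {A : Type u} [Ring A] [Algebra 𝕂 A]
    [HasDerivedCategory.{w} (ModuleCat.{u} A)]
    (s : A) (hn : IsNormalElement s) (hr : IsRegular s) :
    Nonempty (TriangulatedRightDerivedFunctor 𝕂
      (homHomotopyFunctor (koszulComplex 𝕂 s hn hr))) ∧
    Nonempty (TriangulatedLeftDerivedFunctor 𝕂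
      ((completionFunctor s).mapHomotopyCategory (ComplexShape.up ℤ))) ∧
    ∀ (RHom : TriangulatedRightDerivedFunctor 𝕂
        (homHomotopyFunctor (koszulComplex 𝕂 s hn hr)))
      (LΛ : TriangulatedLeftDerivedFunctor 𝕂
        ((completionFunctor s).mapHomotopyCategory (ComplexShape.up ℤ))),
      ∃ ω : RHom.functor ≅ LΛ.functor, NatTrans.CommShift ω.hom ℤ := by
  let := hn.oreSet hr
  let f := oreLocalizationAlgHom 𝕂 (Submonoid.powers s)
  have hf : Function.Injective f := injective_oreLocalizationAlgHom 𝕂 hr.left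
  have hu : IsUnit (f s) := isUnit_oreLocalizationAlgHom 𝕂
  have hB : ∀ x, ∃ (n : ℕ) (a : A), x * f s ^ n = f a :=
    exists_mul_pow_eq_oreLocalizationAlgHom 𝕂 hn
  let b := telescopeBasis f hn hf hu
  have hT : Projective (leftFractionSum f hn) :=
    (isFreeFamily_leftFractionSum f hn hf hu).projective
  let hι := twoTermKernel_telescopeProj f hn hB
  exact ⟨⟨b.rightDerivedFunctor hn hr.left hι⟩, ⟨b.leftDerivedFunctor hn hr.left⟩,
    b.exists_iso_commShift hn hr.left hι⟩
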